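/- Let $\beta>-\tfrac12$. There are constants $a(\beta),A(\beta)>0$ depending only on $\beta$ such that the following holds. Let $D\subset\mathbb C$ be a bounded convex domain (nonempty and open), with support function $h(\varphi)=\max_{z\in\overline D}\operatorname{Re}(ze^{i\varphi})$, $\varphi\in\mathbb R$, and let $d\Delta$ be the Lebesgue–Stieltjes measure of the nondecreasing function $\Delta(\varphi)=h'(\varphi)+\int_0^\varphi h(\theta)\,d\theta$, where $h'$ is the right derivative (so $\Delta(\varphi_2)-\Delta(\varphi_1)$ is the length of the arc of $\partial D$ between the points of contact of two support lines). All integrals with respect to $d\Delta$ are over one half-open period of length $2\pi$. Let $m$ be Lebesgue measure on $\mathbb C$, let $K(\lambda)=\int_D|e^{\lambda z}|^2\,dm(z)$, and for $t<0$ let $s(t,\varphi)$ be the area of the intersection of $D_\varphi=\{ze^{i\varphi}-h(\varphi):z\in D\}$ with the strip $\{w: t<\operatorname{Re}w<0\}$. Let $F=B(\gamma)$, that is, $F$ is an entire function of exponential type, $\gamma$ is analytic in $\mathbb C\setminus\overline D$, and $\gamma(z)=\sum_{k\ge0}F^{(k)}(0)/z^{k+1}$ for all sufficiently large $|z|$.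 Suppose that $$\|F\|^2=\int_0^{2\pi}\int_0^\infty\frac{|F(re^{i\varphi})|^2}{K(re^{i\varphi})\,r^{2\beta}}\,dr\,d\Delta(\varphi)<\infty .$$ For $\zeta\in\mathbb C\setminus\overline D$ put $$p(\zeta)=\int_{\Theta(\zeta)}\frac{(\operatorname{Re}\zeta e^{i\theta}-h(\theta))^{2\beta+3}}{s(h(\theta)-\operatorname{Re}\zeta e^{i\theta},\theta)}\,d\Delta(\theta),$$ where $\Theta(\zeta)=\{\theta:\operatorname{Re}\zeta e^{i\theta}>h(\theta)\}$ is the set of directions (modulo $2\pi$) for which the support line $\{z:\operatorname{Re}ze^{i\theta}=h(\theta)\}$ separates $\zeta$ from $D$. Then $$a(\beta)\|F\|^2\le\int_{\mathbb C\setminus\overline D}|\gamma''(\zeta)|^2\,p(\zeta)\,dm(\zeta)\le A(\beta)\|F\|^2 .$$ -/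

import Mathlib

open MeasureTheory

noncomputable section

/-- A bounded convex domain of the complex plane: a nonempty bounded convex open set. -/
structure BoundedConvexDomain where
  carrier : Set ℂ
  isOpen : IsOpen carrier
  nonempty : carrier.Nonempty
  convex : Convex ℝ carrier
  isBounded : Bornology.IsBounded carrier

namespace BoundedConvexDomain

variable (D : BoundedConvexDomain)

/-- The linear functional `z ↦ Re (z e^{iφ})`. -/
def height (φ : ℝ) (z : ℂ) : ℝ := (z * Complex.exp (φ * Complex.I)).re

/-- The support function `h(φ) = max_{z ∈ closure D} Re (z e^{iφ})`. -/
def support (φ : ℝ) : ℝ := sSup (height φ '' closure D.carrier)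

/-- `Δ(φ) = h'(φ) + ∫_0^φ h(θ) dθ`, with `h'` the right derivative of `h`. The increment of `Δ`
is the length of the boundary arc between the points of contact of two support lines. -/
def arcLength (φ : ℝ) : ℝ :=
  derivWithin D.support (Set.Ioi φ) φ + ∫ θ in (0 : ℝ)..φ, D.support θ

theorem isCompact_closure : IsCompact (closure D.carrier) :=
  D.isBounded.isCompact_closure

theorem continuous_height : Continuous (fun q : ℝ × ℂ => height q.1 q.2) := by
  unfold height; fun_prop

theorem continuous_support : Continuous D.support :=
  D.isCompact_closure.continuous_sSup (f := height) continuous_height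

theorem bddAbove_height (φ : ℝ) : BddAbove (height φ '' closure D.carrier) :=
  (D.isCompact_closure.image (continuous_height.comp (Continuous.prodMk_right φ))).bddAbove

/-- The support function is attained on the closure of `D`. -/
theorem exists_height_eq (φ : ℝ) :
    ∃ z ∈ closure D.carrier, height φ z = D.support φ := by
  obtain ⟨z, hz, h⟩ := D.isCompact_closure.exists_sSup_image_eq D.nonempty.closure
    (continuous_height.comp (Continuous.prodMk_right φ)).continuousOn
  exact ⟨z, hz, h.symm⟩

theorem height_le_support {z : ℂ} (hz : z ∈ closure D.carrier) (φ : ℝ) :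
    height φ z ≤ D.support φ :=
  le_csSup (D.bddAbove_height φ) ⟨z, hz, rfl⟩

theorem height_eq (φ : ℝ) (z : ℂ) :
    height φ z = z.re * Real.cos φ - z.im * Real.sin φ := by
  simp [height, Complex.mul_re, Complex.exp_ofReal_mul_I_re, Complex.exp_ofReal_mul_I_im]

/-- The second antiderivative of the support function. -/
def supportPrim (φ : ℝ) : ℝ := ∫ s in (0 : ℝ)..φ, ∫ θ in (0 : ℝ)..s, D.support θ

theorem hasDerivAt_prim (φ : ℝ) :
    HasDerivAt (fun s => ∫ θ in (0 : ℝ)..s, D.support θ) (D.support φ) φ :=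
  intervalIntegral.integral_hasDerivAt_right (D.continuous_support.intervalIntegrable _ _)
    (D.continuous_support.stronglyMeasurableAtFilter _ _) D.continuous_support.continuousAt

theorem hasDerivAt_supportPrim (φ : ℝ) :
    HasDerivAt D.supportPrim (∫ θ in (0 : ℝ)..φ, D.support θ) φ := by
  have hc : Continuous (fun s => ∫ θ in (0 : ℝ)..s, D.support θ) :=
    continuous_iff_continuousAt.2 fun s => (D.hasDerivAt_prim s).continuousAt
  exact intervalIntegral.integral_hasDerivAt_right (hc.intervalIntegrable _ _)
    (hc.stronglyMeasurableAtFilter _ _) hc.continuousAt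

theorem convexOn_height_add (z : ℂ) (hz : z ∈ closure D.carrier) :
    ConvexOn ℝ Set.univ (fun φ => height φ z + D.supportPrim φ) := by
  have h1 : ∀ φ : ℝ, HasDerivAt (fun φ => height φ z + D.supportPrim φ)
      (-z.re * Real.sin φ - z.im * Real.cos φ + ∫ θ in (0 : ℝ)..φ, D.support θ) φ := by
    intro φ
    have h := (((Real.hasDerivAt_cos φ).const_mul z.re).sub
      ((Real.hasDerivAt_sin φ).const_mul z.im)).add (D.hasDerivAt_supportPrim φ)
    have he : (fun φ => height φ z + D.supportPrim φ)
        = (fun φ => z.re * Real.cos φ) - (fun φ => z.im * Real.sin φ) + D.supportPrim := by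
      funext t; simp [height_eq]
    rw [he]
    exact h.congr_deriv (by ring)
  have h2 : ∀ φ : ℝ, HasDerivAt (fun φ : ℝ => -z.re * Real.sin φ - z.im * Real.cos φ +
      ∫ θ in (0 : ℝ)..φ, D.support θ) (D.support φ - height φ z) φ := by
    intro φ
    have h := (((Real.hasDerivAt_sin φ).const_mul (-z.re)).sub
      ((Real.hasDerivAt_cos φ).const_mul z.im)).add (D.hasDerivAt_prim φ)
    exact h.congr_deriv (by rw [height_eq]; ring)
  refine convexOn_of_hasDerivWithinAt2_nonneg (convex_univ)
    (fun φ _ => (h1 φ).continuousAt.continuousWithinAt)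
    (fun φ _ => (h1 φ).hasDerivWithinAt) (fun φ _ => (h2 φ).hasDerivWithinAt) ?_
  intro φ _
  linarith [D.height_le_support hz φ]

theorem convexOn_support_add : ConvexOn ℝ Set.univ (fun φ => D.support φ + D.supportPrim φ) := by
  refine ⟨convex_univ, ?_⟩
  intro x _ y _ a b ha hb hab
  obtain ⟨z, hz, he⟩ := D.exists_height_eq (a • x + b • y)
  have h := (D.convexOn_height_add z hz).2 (Set.mem_univ x) (Set.mem_univ y) ha hb hab
  have hx := mul_le_mul_of_nonneg_left (D.height_le_support hz x) ha
  have hy := mul_le_mul_of_nonneg_left (D.height_le_support hz y) hb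
  simp only [smul_eq_mul] at *
  rw [← he]
  linarith

/-- The right derivative of the support function exists everywhere. -/
theorem hasDerivWithinAt_support (φ : ℝ) :
    HasDerivWithinAt D.support (derivWithin D.support (Set.Ioi φ) φ) (Set.Ioi φ) φ := by
  have h := (D.convexOn_support_add.hasDerivWithinAt_rightDeriv_of_mem_interior
    (x := φ) (by simp)).sub (D.hasDerivAt_supportPrim φ).hasDerivWithinAt
  have he : (fun φ => D.support φ + D.supportPrim φ) - D.supportPrim = D.support := by
    funext t; simp
  rw [he] at h
  exact h.differentiableWithinAt.hasDerivWithinAt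

theorem monotone_arcLength : Monotone D.arcLength := by
  have h := D.convexOn_support_add.monotoneOn_rightDeriv
  have he : (fun x => derivWithin (fun φ => D.support φ + D.supportPrim φ) (Set.Ioi x) x)
      = D.arcLength := by
    funext x
    exact ((D.hasDerivWithinAt_support x).add
      (D.hasDerivAt_supportPrim x).hasDerivWithinAt).derivWithin (uniqueDiffWithinAt_Ioi x)
  rw [he, interior_univ] at h
  exact monotoneOn_univ.1 h

/-- The Lebesgue-Stieltjes measure `dΔ` on the line. -/
def arcMeasure : Measure ℝ := D.monotone_arcLength.stieltjesFunction.measure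

/-- The measure `dΔ` on one period. The half-open period counts an atom at `0 ≡ 2π` once. -/
def circleArcMeasure : Measure ℝ := D.arcMeasure.restrict (Set.Ioc 0 (2 * Real.pi))

/-- `K(l) = ∫_D |e^{l z}|² dm(z)`. -/
def bergmanWeight (l : ℂ) : ℝ := ∫ z in D.carrier, ‖Complex.exp (l * z)‖ ^ 2

/-- The domain `D_φ`, the image of `D` under `z ↦ z e^{iφ} - h(φ)`. -/
def rotated (φ : ℝ) : Set ℂ :=
  (fun z : ℂ => z * Complex.exp (φ * Complex.I) - (D.support φ : ℂ)) '' D.carrier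

/-- `s(t, φ)`, the area of the part of `D_φ` in the strip `t < Re w < 0`. -/
def stripArea (t φ : ℝ) : ℝ :=
  volume.real (D.rotated φ ∩ {w : ℂ | t < w.re ∧ w.re < 0})

/-- `‖F‖² = ∫_0^{2π} ∫_0^∞ |F(re^{iφ})|² / (K(re^{iφ}) r^{2β}) dr dΔ(φ)`, a value in `[0, ∞]`. -/
def normSq (β : ℝ) (F : ℂ → ℂ) : ENNReal :=
  ∫⁻ φ, ∫⁻ r in Set.Ioi (0 : ℝ),
    ENNReal.ofReal (‖F (r * Complex.exp (φ * Complex.I))‖ ^ 2 /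
      (D.bergmanWeight (r * Complex.exp (φ * Complex.I)) * r ^ (2 * β)))
    ∂volume ∂D.circleArcMeasure

/-- The directions `θ` for which the support line `{z | Re (z e^{iθ}) = h(θ)}` separates `ζ`
from `D`; modulo `2π` they form the arc `(φ₋(ζ), φ₊(ζ))` between the directions of the two
support lines through `ζ`. -/
def separatingDirections (ζ : ℂ) : Set ℝ := {θ | D.support θ < height θ ζ}

/-- `p(ζ)`, the integral of `(Re ζe^{iθ} - h(θ))^{2β+3} / s(h(θ) - Re ζe^{iθ}, θ)` against
`dΔ(θ)` over the separating directions. -/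
def weight (β : ℝ) (ζ : ℂ) : ENNReal :=
  ∫⁻ θ in D.separatingDirections ζ,
    ENNReal.ofReal ((height θ ζ - D.support θ) ^ (2 * β + 3) /
      D.stripArea (D.support θ - height θ ζ) θ) ∂D.circleArcMeasure

/-- `F = B(γ)`: `F` is entire, `γ` is analytic off the closure of `D`, and near infinity
`γ(z) = ∑ F^{(k)}(0) / z^{k+1}`. The convergence of the series makes `F` of exponential type and
makes `γ` vanish at infinity. -/
structure IsBorelPair (F γ : ℂ → ℂ) : Prop where
  entire : Differentiable ℂ F
  analytic : DifferentiableOn ℂ γ (closure D.carrier)ᶜ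
  series : ∀ᶠ z in Bornology.cobounded ℂ,
    HasSum (fun k : ℕ => iteratedDeriv k F 0 / z ^ (k + 1)) (γ z)

end BoundedConvexDomain

end

/-!
Fix a direction `φ`, write `h` for the support function and `S(x) = s(-x, φ)` for the area of the
cap of `D` of depth `x` below the support line in that direction.

By Tonelli's theorem (`lintegral_weight_eq`) the weighted integral of `|γ''|²` is the integral
against `dΔ(φ)` of the contributions of the half-planes `Re ζe^{iφ} > h(φ)`, on which `ζ` carries
the weight `x^{2β+3} / S(x)`, where `x` is its distance from the support line. It therefore suffices
to compare, for almost every `φ`, this contribution (`directionEnergy`) with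
`∫ |F(re^{iφ})|² / (K(re^{iφ}) r^{2β}) dr`.

When the latter integral is finite, the Laplace integral of `F` along the ray converges on the whole
half-plane (`laplaceConvergent_of_lintegral_lt_top`) and represents `γ` there
(`IsBorelPair.eqOn_laplace`): far out this is the termwise transform of the Taylor series, and the
identity theorem does the rest. Hence on the line at distance `x` from the support line, `γ''` is,
up to a unimodular factor, the Fourier transform of `r² F(re^{iφ}) e^{-r(h+x)}`. Plancherel's theorem
(`lintegral_enorm_fourier_sq`) turns the contribution of `φ` into
`2π ∫ |F(re^{iφ})|² r⁴ e^{-2rh} M(r) dr` with `M(r) = ∫ x^{2β+3} e^{-2rx} / S(x) dx`.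

What remains is that `r⁴ e^{-2rh} M(r)` is comparable with `1 / (K(re^{iφ}) r^{2β})`, with
constants that depend on `β` alone. This holds because `S` increases while `S(x) / x²` decreases, the latter by
convexity (`sq_mul_stripArea_le`). Put `ρ = 1/(2r)`. The growth of `S` makes the layers of `D` of
depth about `ρ` dominate in `K`, so that `K(re^{iφ})` is comparable with `e^{2rh} S(ρ)`
(`bergmanWeight_le`, `le_bergmanWeight`); in the same way `M(r)` is comparable with
`ρ^{2β+4} / S(ρ)` (`lintegral_capWeight_le`, `le_lintegral_capWeight`).
-/

namespace BoundedConvexDomain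

variable (D : BoundedConvexDomain)

/-! ### Caps of the domain -/

/-- The cap of depth `x` in the direction `φ`: the points of `D` at distance less than `x` from
the support line `{z | Re (z e^{iφ}) = h(φ)}`. -/
def cap (φ x : ℝ) : Set ℂ := D.carrier ∩ {z | D.support φ - x < height φ z}

theorem continuous_height_right (φ : ℝ) : Continuous (height φ) :=
  continuous_height.comp (Continuous.prodMk_right φ)

theorem isOpen_cap (φ x : ℝ) : IsOpen (D.cap φ x) :=
  D.isOpen.inter (isOpen_lt continuous_const (continuous_height_right φ))

theorem height_add_mul_exp (φ x : ℝ) (z : ℂ) :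
    height φ (z + x * Complex.exp (-(φ * Complex.I))) = height φ z + x := by
  rw [height, add_mul, mul_assoc, ← Complex.exp_add]
  simp [height]

theorem height_lt_support {z : ℂ} (hz : z ∈ D.carrier) (φ : ℝ) : height φ z < D.support φ := by
  have hc : Continuous fun x : ℝ => z + x * Complex.exp (-(φ * Complex.I)) := by fun_prop
  have hU : (fun x : ℝ => z + x * Complex.exp (-(φ * Complex.I))) ⁻¹' D.carrier ∈ nhds (0 : ℝ) :=
    hc.continuousAt.preimage_mem_nhds (D.isOpen.mem_nhds (by simpa using hz))
  obtain ⟨ε, hε, hb⟩ := Metric.mem_nhds_iff.1 hU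
  have h1 : ε / 2 ∈ Metric.ball (0 : ℝ) ε := by
    rw [Metric.mem_ball, dist_zero_right, Real.norm_of_nonneg (by positivity)]; linarith
  have h2 := D.height_le_support (subset_closure (hb h1)) φ
  rw [height_add_mul_exp] at h2
  linarith

/-- Coordinates adapted to the direction `φ`: `(x, y)` is sent to the point `z` with
`z e^{iφ} = h(φ) + x + i y`. -/
noncomputable def frame (φ : ℝ) : ℝ × ℝ ≃ᵐ ℂ :=
  (Complex.measurableEquivRealProd.symm.trans (MeasurableEquiv.addLeft (D.support φ : ℂ))).trans
    (rotation (Circle.exp (-φ))).toHomeomorph.toMeasurableEquiv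

theorem frame_apply (φ : ℝ) (q : ℝ × ℝ) :
    D.frame φ q = (D.support φ + (q.1 + q.2 * Complex.I)) * Complex.exp (-(φ * Complex.I)) := by
  simp only [frame, MeasurableEquiv.trans_apply, Complex.measurableEquivRealProd_symm_apply,
    MeasurableEquiv.coe_addLeft, Homeomorph.toMeasurableEquiv_coe,
    LinearIsometryEquiv.coe_toHomeomorph, rotation_apply, Circle.coe_exp]
  rw [mul_comm, Complex.mk_eq_add_mul_I]
  simp

theorem measurePreserving_frame (φ : ℝ) : MeasurePreserving (D.frame φ) volume volume :=
  ((rotation (Circle.exp (-φ))).measurePreserving.comp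
    (measurePreserving_add_left volume (D.support φ : ℂ))).comp
      (Complex.volume_preserving_equiv_real_prod.symm Complex.measurableEquivRealProd)

theorem frame_mul_exp (φ : ℝ) (q : ℝ × ℝ) :
    D.frame φ q * Complex.exp (φ * Complex.I) = D.support φ + (q.1 + q.2 * Complex.I) := by
  rw [frame_apply, mul_assoc, ← Complex.exp_add]; simp

theorem height_frame (φ : ℝ) (q : ℝ × ℝ) : height φ (D.frame φ q) = D.support φ + q.1 := by
  rw [height, frame_mul_exp]; simp

theorem stripArea_neg (x φ : ℝ) : D.stripArea (-x) φ = volume.real (D.cap φ x) := by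
  have he : D.rotated φ ∩ {w : ℂ | -x < w.re ∧ w.re < 0}
      = (fun w : ℂ => D.frame φ (Complex.measurableEquivRealProd w)) ⁻¹' D.cap φ x := by
    have hf : ∀ w : ℂ, D.frame φ (Complex.measurableEquivRealProd w)
        = (w + D.support φ) * Complex.exp (-(φ * Complex.I)) := by
      intro w
      rw [frame_apply]
      simp [Complex.measurableEquivRealProd_apply, Complex.re_add_im, add_comm]
    ext w
    simp only [rotated, Set.mem_inter_iff, Set.mem_image, Set.mem_ofPred_eq, Set.mem_preimage, cap,
      height_frame, Complex.measurableEquivRealProd_apply]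
    constructor
    · rintro ⟨⟨z, hz, rfl⟩, h1, -⟩
      refine ⟨?_, by linarith⟩
      have := hf (z * Complex.exp (φ * Complex.I) - D.support φ)
      rw [Complex.measurableEquivRealProd_apply] at this
      rw [this, sub_add_cancel, mul_assoc, ← Complex.exp_add]
      simpa using hz
    · rintro ⟨h1, h2⟩
      have h3 := D.height_lt_support h1 φ
      rw [height_frame] at h3
      refine ⟨⟨_, h1, ?_⟩, by linarith, by simpa using h3⟩
      rw [frame_mul_exp]
      simp [Complex.re_add_im]
  have hm : MeasurePreserving (fun w : ℂ => D.frame φ (Complex.measurableEquivRealProd w)) :=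
    (D.measurePreserving_frame φ).comp Complex.volume_preserving_equiv_real_prod
  rw [stripArea, he, Measure.real, hm.measure_preimage (D.isOpen_cap φ x).nullMeasurableSet]
  rfl

theorem volume_carrier_lt_top : volume D.carrier < ⊤ := D.isBounded.measure_lt_top

theorem volume_cap_ne_top (φ x : ℝ) : volume (D.cap φ x) ≠ ⊤ :=
  ((measure_mono Set.inter_subset_left).trans_lt D.volume_carrier_lt_top).ne

theorem volume_cap (φ x : ℝ) : volume (D.cap φ x) = ENNReal.ofReal (D.stripArea (-x) φ) := by
  rw [stripArea_neg, Measure.real, ENNReal.ofReal_toReal (D.volume_cap_ne_top φ x)]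

theorem stripArea_neg_mono (φ : ℝ) : Monotone fun x => D.stripArea (-x) φ := by
  intro x y hxy
  simp only [stripArea_neg]
  refine measureReal_mono (fun z hz => ⟨hz.1, ?_⟩) (D.volume_cap_ne_top φ y)
  have h : D.support φ - x < height φ z := hz.2
  simp only [Set.mem_ofPred_eq]
  linarith

theorem stripArea_neg_pos (φ : ℝ) {x : ℝ} (hx : 0 < x) : 0 < D.stripArea (-x) φ := by
  rw [stripArea_neg]
  refine ENNReal.toReal_pos ((D.isOpen_cap φ x).measure_ne_zero volume ?_) (D.volume_cap_ne_top φ x)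
  obtain ⟨z, hz, he⟩ := D.exists_height_eq φ
  obtain ⟨w, hw1, hw2⟩ := mem_closure_iff.1 hz {z | D.support φ - x < height φ z}
    (isOpen_lt continuous_const (continuous_height_right φ))
    (by simp only [Set.mem_ofPred_eq]; linarith)
  exact ⟨w, hw2, hw1⟩

/-- The homothety with ratio `t` centred at a contact point of the support line maps the cap of
depth `x` into the cap of depth `t x`, by convexity of `D`. -/
theorem sq_mul_stripArea_le (φ x : ℝ) {t : ℝ} (ht : t ∈ Set.Ioc (0 : ℝ) 1) :
    t ^ 2 * D.stripArea (-x) φ ≤ D.stripArea (-(t * x)) φ := by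
  obtain ⟨z, hz, he⟩ := D.exists_height_eq φ
  have hsub : AffineMap.homothety z t '' D.cap φ x ⊆ D.cap φ (t * x) := by
    rintro _ ⟨w, hw, rfl⟩
    have hw2 : D.support φ - x < height φ w := hw.2
    rw [AffineMap.homothety_apply, vsub_eq_sub, vadd_eq_add, add_comm]
    constructor
    · have := D.convex.add_smul_sub_mem_interior' hz (D.isOpen.interior_eq.symm ▸ hw.1) ht
      rwa [D.isOpen.interior_eq] at this
    · have h : height φ (z + t • (w - z)) = height φ z + t * (height φ w - height φ z) := by
        simp only [height_eq, Complex.add_re, Complex.add_im, Complex.real_smul, Complex.sub_re,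
          Complex.sub_im, Complex.re_ofReal_mul, Complex.im_ofReal_mul]
        ring
      simp only [Set.mem_ofPred_eq, h, he]
      nlinarith [ht.1]
  have h := measure_mono (μ := volume) hsub
  rw [Measure.addHaar_image_homothety, Complex.finrank_real_complex, volume_cap, volume_cap,
    ← ENNReal.ofReal_mul (abs_nonneg _), abs_of_nonneg (by positivity)] at h
  refine (ENNReal.ofReal_le_ofReal_iff ?_).1 h
  rw [stripArea_neg]; exact measureReal_nonneg

/-- The cap areas grow at most quadratically. -/
theorem stripArea_mul_le (φ : ℝ) {u x : ℝ} (hu : 0 < u) (hx : 0 < x) :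
    D.stripArea (-(u * x)) φ ≤ (1 + u ^ 2) * D.stripArea (-x) φ := by
  have hS := D.stripArea_neg_pos φ hx
  rcases le_total u 1 with h | h
  · have h1 : D.stripArea (-(u * x)) φ ≤ D.stripArea (-x) φ :=
      D.stripArea_neg_mono φ (by nlinarith)
    nlinarith [sq_nonneg u]
  · have h1 := D.sq_mul_stripArea_le φ (u * x) ⟨inv_pos.2 hu, inv_le_one_of_one_le₀ h⟩
    rw [inv_mul_cancel_left₀ hu.ne', inv_pow, inv_mul_le_iff₀ (by positivity)] at h1
    nlinarith

theorem one_div_stripArea_le (φ : ℝ) {u x : ℝ} (hu : 0 < u) (hx : 0 < x) :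
    1 / D.stripArea (-(u * x)) φ ≤ (1 + (u ^ 2)⁻¹) / D.stripArea (-x) φ := by
  have h := D.stripArea_mul_le φ (inv_pos.2 hu) (mul_pos hu hx)
  rw [inv_mul_cancel_left₀ hu.ne', inv_pow] at h
  rw [div_le_div_iff₀ (D.stripArea_neg_pos φ (mul_pos hu hx)) (D.stripArea_neg_pos φ hx), one_mul]
  exact h

/-! ### The Bergman weight -/

theorem norm_exp_polar (r φ : ℝ) (z : ℂ) :
    ‖Complex.exp (r * Complex.exp (φ * Complex.I) * z)‖ ^ 2 = Real.exp (2 * r * height φ z) := by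
  rw [Complex.norm_exp, ← Real.exp_nat_mul]
  congr 1
  rw [mul_assoc, Complex.re_ofReal_mul, mul_comm (Complex.exp _) z, height]
  push_cast
  ring

theorem bergmanWeight_polar (r φ : ℝ) :
    D.bergmanWeight (r * Complex.exp (φ * Complex.I))
      = ∫ z in D.carrier, Real.exp (2 * r * height φ z) := by
  simp only [bergmanWeight, norm_exp_polar]

theorem integrableOn_exp_height (r φ : ℝ) :
    IntegrableOn (fun z => Real.exp (2 * r * height φ z)) D.carrier := by
  have hc : Continuous fun z => Real.exp (2 * r * height φ z) :=
    Real.continuous_exp.comp (continuous_const.mul (continuous_height_right φ))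
  exact (hc.continuousOn.integrableOn_compact D.isCompact_closure).mono_set subset_closure

theorem bergmanWeight_le_area (r φ : ℝ) (hr : 0 < r) :
    D.bergmanWeight (r * Complex.exp (φ * Complex.I))
      ≤ volume.real D.carrier * Real.exp (2 * r * D.support φ) := by
  rw [bergmanWeight_polar, ← smul_eq_mul (volume.real D.carrier), ← setIntegral_const]
  refine setIntegral_mono_on (D.integrableOn_exp_height r φ)
    (integrableOn_const D.volume_carrier_lt_top.ne) D.isOpen.measurableSet fun z hz => ?_
  exact Real.exp_le_exp.2 (mul_le_mul_of_nonneg_left (D.height_lt_support hz φ).le (by positivity))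

/-- On the cap of depth `1/(2r)` the integrand of `K` is within a factor `e` of its supremum. -/
theorem le_bergmanWeight (r φ : ℝ) (hr : 0 < r) :
    Real.exp (-1) * (Real.exp (2 * r * D.support φ) * D.stripArea (-(1 / (2 * r))) φ)
      ≤ D.bergmanWeight (r * Complex.exp (φ * Complex.I)) := by
  rw [bergmanWeight_polar, stripArea_neg]
  calc _ = ∫ z in D.cap φ (1 / (2 * r)), Real.exp (-1) * Real.exp (2 * r * D.support φ) := by
        rw [setIntegral_const, smul_eq_mul]; ring
    _ ≤ ∫ z in D.cap φ (1 / (2 * r)), Real.exp (2 * r * height φ z) := by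
        refine setIntegral_mono_on (integrableOn_const (D.volume_cap_ne_top φ _))
          ((D.integrableOn_exp_height r φ).mono_set Set.inter_subset_left)
          (D.isOpen_cap φ _).measurableSet fun z hz => ?_
        rw [← Real.exp_add, Real.exp_le_exp]
        have h : D.support φ - 1 / (2 * r) < height φ z := hz.2
        have h1 := mul_lt_mul_of_pos_left h (by positivity : 0 < 2 * r)
        rw [mul_sub, mul_one_div_cancel (by positivity)] at h1
        linarith
    _ ≤ _ := by
        refine setIntegral_mono_set (D.integrableOn_exp_height r φ)
          (Filter.Eventually.of_forall fun z => (Real.exp_pos _).le)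
          (Filter.Eventually.of_forall fun z hz => hz.1)

theorem bergmanWeight_pos (r φ : ℝ) (hr : 0 < r) :
    0 < D.bergmanWeight (r * Complex.exp (φ * Complex.I)) := by
  refine lt_of_lt_of_le ?_ (D.le_bergmanWeight r φ hr)
  have := D.stripArea_neg_pos φ (by positivity : 0 < 1 / (2 * r))
  positivity

theorem summable_exp_neg_mul :
    Summable fun k : ℕ => Real.exp (-k) * (1 + ((k : ℝ) + 1) ^ 2) := by
  have h : ∀ n : ℕ, Summable fun k : ℕ => (k : ℝ) ^ n * Real.exp (-1) ^ k := fun n =>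
    summable_pow_mul_geometric_of_norm_lt_one n (by
      rw [Real.norm_of_nonneg (Real.exp_pos _).le, Real.exp_lt_one_iff]; norm_num)
  refine (((h 2).add ((h 1).mul_left 2)).add ((h 0).mul_left 2)).congr fun k => ?_
  rw [← Real.exp_nat_mul]
  simp only [mul_neg, mul_one]
  ring

/-- The constant in the upper bound of the Bergman weight by a cap area. -/
noncomputable def layerConst : ℝ := ∑' k : ℕ, Real.exp (-k) * (1 + ((k : ℝ) + 1) ^ 2)

theorem layerConst_pos : 0 < layerConst :=
  summable_exp_neg_mul.tsum_pos (fun _ => by positivity) 0 (by positivity)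

/-- The mass of `e^{2r Re(z e^{iφ})}` sits in the cap of depth `1/(2r)`: the layer at depth about
`k/(2r)` has weight `e^{-k}` and area `O(k²)` times that of the first one. -/
theorem bergmanWeight_le (r φ : ℝ) (hr : 0 < r) :
    D.bergmanWeight (r * Complex.exp (φ * Complex.I))
      ≤ layerConst * (Real.exp (2 * r * D.support φ) * D.stripArea (-(1 / (2 * r))) φ) := by
  set S := D.stripArea (-(1 / (2 * r))) φ with hS
  have hSpos : 0 < S := D.stripArea_neg_pos φ (by positivity : 0 < 1 / (2 * r))
  set E := Real.exp (2 * r * D.support φ) with hE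
  have hEpos : 0 < E := Real.exp_pos _
  set A : ℕ → Set ℂ := fun k => D.cap φ (((k : ℝ) + 1) * (1 / (2 * r))) with hA
  have hpt : ∀ z ∈ D.carrier, ENNReal.ofReal (Real.exp (2 * r * height φ z)) ≤
      ∑' k : ℕ, (A k).indicator (fun _ => ENNReal.ofReal (E * Real.exp (-k))) z := by
    intro z hz
    set u := 2 * r * (D.support φ - height φ z) with hu
    have hupos : 0 ≤ u := mul_nonneg (by positivity) (by linarith [D.height_lt_support hz φ])
    refine le_trans ?_ (ENNReal.le_tsum ⌊u⌋₊)
    have hmem : z ∈ A ⌊u⌋₊ := by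
      refine ⟨hz, ?_⟩
      have h1 := Nat.lt_floor_add_one u
      have h2 : D.support φ - height φ z = u * (1 / (2 * r)) := by rw [hu]; field_simp
      have h3 := mul_lt_mul_of_pos_right h1 (by positivity : 0 < 1 / (2 * r))
      simp only [Set.mem_ofPred_eq]
      linarith
    rw [Set.indicator_of_mem hmem]
    refine ENNReal.ofReal_le_ofReal ?_
    rw [hE, ← Real.exp_add, Real.exp_le_exp]
    have := Nat.floor_le hupos
    linarith [hu]
  have hl : ENNReal.ofReal (D.bergmanWeight (r * Complex.exp (φ * Complex.I)))
      ≤ ENNReal.ofReal (layerConst * (E * S)) := by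
    rw [bergmanWeight_polar, ofReal_integral_eq_lintegral_ofReal (D.integrableOn_exp_height r φ)
      (Filter.Eventually.of_forall fun z => (Real.exp_pos _).le)]
    calc _ ≤ ∫⁻ z in D.carrier,
          ∑' k : ℕ, (A k).indicator (fun _ => ENNReal.ofReal (E * Real.exp (-k))) z :=
        setLIntegral_mono' D.isOpen.measurableSet hpt
      _ ≤ ∫⁻ z, ∑' k : ℕ, (A k).indicator (fun _ => ENNReal.ofReal (E * Real.exp (-k))) z :=
        setLIntegral_le_lintegral _ _
      _ = ∑' k : ℕ, ENNReal.ofReal (E * Real.exp (-k)) * volume (A k) := by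
        rw [lintegral_tsum fun k =>
          (measurable_const.indicator (D.isOpen_cap φ _).measurableSet).aemeasurable]
        exact tsum_congr fun k => lintegral_indicator_const (D.isOpen_cap φ _).measurableSet _
      _ ≤ ∑' k : ℕ, ENNReal.ofReal (Real.exp (-k) * (1 + ((k : ℝ) + 1) ^ 2) * (E * S)) := by
        refine ENNReal.tsum_le_tsum fun k => ?_
        rw [hA]
        dsimp only
        rw [volume_cap, ← ENNReal.ofReal_mul (by positivity)]
        refine ENNReal.ofReal_le_ofReal ?_
        have := D.stripArea_mul_le φ (by positivity : (0 : ℝ) < (k : ℝ) + 1)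
          (by positivity : 0 < 1 / (2 * r))
        calc _ ≤ E * Real.exp (-k) * ((1 + ((k : ℝ) + 1) ^ 2) * S) :=
              mul_le_mul_of_nonneg_left this (by positivity)
          _ = _ := by ring
      _ = _ := by
        rw [← ENNReal.ofReal_tsum_of_nonneg (fun k => by positivity)
          (summable_exp_neg_mul.mul_right _), tsum_mul_right, layerConst]
  exact (ENNReal.ofReal_le_ofReal_iff (by have := layerConst_pos; positivity)).1 hl

end BoundedConvexDomain

/-! ### Plancherel's theorem for integrable functions -/

open FourierTransform ContDiff in
/-- On `L¹ ∩ L²`, the integral defining the Fourier transform represents the `L²` transform, since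
the two agree as distributions; hence it is an isometry for the `L²` norm. -/
theorem lintegral_enorm_fourier_sq {g : ℝ → ℂ} (h1 : Integrable g) (h2 : MemLp g 2) :
    ∫⁻ y, ‖𝓕 g y‖ₑ ^ 2 = ∫⁻ x, ‖g x‖ₑ ^ 2 := by
  set f : Lp ℂ 2 (volume : Measure ℝ) := h2.toLp g with hf
  have hcont : Continuous (𝓕 g) :=
    VectorFourier.fourierIntegral_continuous Real.continuous_fourierChar
      (by exact continuous_inner) h1
  have hae : ∀ᵐ y, (𝓕 f : Lp ℂ 2 (volume : Measure ℝ)) y = 𝓕 g y := by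
    refine ae_eq_of_integral_contDiff_smul_eq
      ((Lp.memLp _).locallyIntegrable (by norm_num)) hcont.locallyIntegrable fun φ hφ hφc => ?_
    have hg₁ : HasCompactSupport (Complex.ofRealCLM ∘ φ) := hφc.comp_left rfl
    have hg₂ : ContDiff ℝ ∞ (Complex.ofRealCLM ∘ φ) := by fun_prop
    set ψ := hg₁.toSchwartzMap hg₂ with hψ
    have hψa : ∀ x, ψ x = (φ x : ℂ) := fun x => rfl
    have e1 := congrArg (fun T => T ψ) (Lp.fourier_toTemperedDistribution_eq f)
    simp only [TemperedDistribution.fourier_apply, Lp.toTemperedDistribution_apply] at e1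
    have e2 : ∫ x, (𝓕 ψ) x • f x = ∫ x, (𝓕 ψ) x • g x := by
      refine integral_congr_ae ?_
      filter_upwards [h2.coeFn_toLp] with x hx
      rw [hf, hx]
    have e3 : ∫ x, (𝓕 ψ) x • g x = ∫ x, ψ x • 𝓕 g x := by
      have := VectorFourier.integral_fourierIntegral_smul_eq_flip (μ := volume) (ν := volume)
        (L := innerₗ ℝ) (f := (ψ : ℝ → ℂ)) (g := g) Real.continuous_fourierChar
        (by exact continuous_inner) ψ.integrable h1
      simpa [flip_innerₗ] using! this
    have e4 : ∀ F : ℝ → ℂ, ∫ x, φ x • F x = ∫ x, ψ x • F x := fun F => by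
      simp only [hψa, Complex.real_smul, smul_eq_mul]
    rw [e4, e4, ← e1, e2, e3]
  have key : ∀ (u : ℝ → ℂ) (v : Lp ℂ 2 (volume : Measure ℝ)), (∀ᵐ y, v y = u y) →
      ∫⁻ y, ‖u y‖ₑ ^ 2 = ‖v‖ₑ ^ 2 := by
    intro u v huv
    rw [Lp.enorm_def, eLpNorm_eq_lintegral_rpow_enorm_toReal (by norm_num) (by norm_num)]
    simp only [ENNReal.toReal_ofNat, ENNReal.rpow_ofNat, one_div]
    rw [← ENNReal.rpow_natCast, ← ENNReal.rpow_mul]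
    norm_num
    exact lintegral_congr_ae (huv.mono fun y hy => by simp [hy])
  rw [key _ _ hae, key _ _ h2.coeFn_toLp]
  congr 1
  rw [← ofReal_norm, ← ofReal_norm, Lp.norm_fourier_eq]

/-! ### Laplace transforms -/

/-- The Laplace transform `∫_0^∞ f(r) e^{-rw} dr`. -/
noncomputable def laplace (f : ℝ → ℂ) (w : ℂ) : ℂ :=
  ∫ r in Set.Ioi (0 : ℝ), f r * Complex.exp (-(r * w))

/-- The Laplace integral of `f` converges absolutely on the half-plane `Re w > h`. -/
def LaplaceConvergent (f : ℝ → ℂ) (h : ℝ) : Prop :=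
  ∀ w : ℂ, h < w.re → IntegrableOn (fun r : ℝ => f r * Complex.exp (-(r * w))) (Set.Ioi 0)

theorem norm_exp_neg_ofReal_mul (r : ℝ) (w : ℂ) :
    ‖Complex.exp (-(r * w))‖ = Real.exp (-(r * w.re)) := by
  rw [Complex.norm_exp]; simp

/-- Convergence on an open half-plane leaves room to absorb a factor `r` into the exponential. -/
theorem LaplaceConvergent.integrableOn_mul {f : ℝ → ℂ} {h : ℝ} (hf : LaplaceConvergent f h)
    {x : ℝ} (hx : h < x) :
    IntegrableOn (fun r : ℝ => r * (‖f r‖ * Real.exp (-(r * x)))) (Set.Ioi 0) := by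
  obtain ⟨y, hy1, hy2⟩ := exists_between hx
  have hi := (hf y (by simpa using hy1)).norm
  simp only [norm_mul, norm_exp_neg_ofReal_mul, Complex.ofReal_re] at hi
  have hm : AEStronglyMeasurable (fun r : ℝ => r * (‖f r‖ * Real.exp (-(r * x))))
      (volume.restrict (Set.Ioi 0)) := by
    have h1 : Continuous fun r : ℝ => r * Real.exp (r * (y - x)) := by fun_prop
    refine (hi.aestronglyMeasurable.mul h1.aestronglyMeasurable).congr
      (Filter.Eventually.of_forall fun r => ?_)
    have e : Real.exp (-(r * x)) = Real.exp (-(r * y)) * Real.exp (r * (y - x)) := by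
      rw [← Real.exp_add]; ring_nf
    simp only [Pi.mul_apply, e]; ring
  refine (hi.const_mul (x - y)⁻¹).mono' hm ?_
  filter_upwards [ae_restrict_mem measurableSet_Ioi] with r hr
  have hr : 0 < r := hr
  rw [Real.norm_of_nonneg (by positivity), inv_mul_eq_div, le_div_iff₀ (by linarith)]
  have e : Real.exp (-(r * y)) = Real.exp (-(r * x)) * Real.exp (r * (x - y)) := by
    rw [← Real.exp_add]; ring_nf
  have h2 : r * (x - y) ≤ Real.exp (r * (x - y)) := by linarith [Real.add_one_le_exp (r * (x - y))]
  rw [e]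
  calc _ = (‖f r‖ * Real.exp (-(r * x))) * (r * (x - y)) := by ring
    _ ≤ (‖f r‖ * Real.exp (-(r * x))) * Real.exp (r * (x - y)) :=
      mul_le_mul_of_nonneg_left h2 (by positivity)
    _ = _ := by ring

theorem LaplaceConvergent.aestronglyMeasurable {f : ℝ → ℂ} {h : ℝ} (hf : LaplaceConvergent f h) :
    AEStronglyMeasurable f (volume.restrict (Set.Ioi 0)) := by
  have h1 := (hf ((h + 1 : ℝ) : ℂ) (by simp)).aestronglyMeasurable
  have h2 : Continuous fun r : ℝ => Complex.exp (r * ((h + 1 : ℝ) : ℂ)) := by fun_prop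
  refine (h1.mul h2.aestronglyMeasurable).congr (Filter.Eventually.of_forall fun r => ?_)
  simp only [Pi.mul_apply, mul_assoc, ← Complex.exp_add]
  simp

theorem LaplaceConvergent.neg_mul {f : ℝ → ℂ} {h : ℝ} (hf : LaplaceConvergent f h) :
    LaplaceConvergent (fun r => -r * f r) h := by
  intro w hw
  have h1 : Continuous fun r : ℝ => -(r : ℂ) := by fun_prop
  have h2 : Continuous fun r : ℝ => Complex.exp (-(r * w)) := by fun_prop
  refine (hf.integrableOn_mul hw).mono' ((h1.aestronglyMeasurable.mul hf.aestronglyMeasurable).mul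
    h2.aestronglyMeasurable) ?_
  filter_upwards [ae_restrict_mem measurableSet_Ioi] with r hr
  have hr : 0 < r := hr
  simp only [norm_mul, norm_neg, Complex.norm_real, norm_exp_neg_ofReal_mul,
    Real.norm_of_nonneg hr.le, mul_assoc]
  exact le_rfl

theorem LaplaceConvergent.hasDerivAt {f : ℝ → ℂ} {h : ℝ} (hf : LaplaceConvergent f h) {w : ℂ}
    (hw : h < w.re) : HasDerivAt (laplace f) (laplace (fun r => -r * f r) w) w := by
  obtain ⟨y, hy1, hy2⟩ := exists_between hw
  have hs : {v : ℂ | y < v.re} ∈ nhds w :=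
    (isOpen_lt continuous_const Complex.continuous_re).mem_nhds hy2
  refine (hasDerivAt_integral_of_dominated_loc_of_deriv_le
    (F := fun v r => f r * Complex.exp (-(r * v)))
    (F' := fun v r => -r * f r * Complex.exp (-(r * v)))
    (bound := fun r => r * (‖f r‖ * Real.exp (-(r * y)))) hs ?_ (hf w hw)
    (hf.neg_mul w hw).aestronglyMeasurable ?_ (hf.integrableOn_mul hy1) ?_).2
  · filter_upwards [hs] with v hv
    exact (hf v (hy1.trans hv)).aestronglyMeasurable
  · filter_upwards [ae_restrict_mem measurableSet_Ioi] with r hr v hv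
    have hr : 0 < r := hr
    have hv : y < v.re := hv
    simp only [norm_mul, norm_neg, Complex.norm_real, norm_exp_neg_ofReal_mul,
      Real.norm_of_nonneg hr.le, mul_assoc]
    gcongr
  · refine Filter.Eventually.of_forall fun r v _ => ?_
    have h1 : HasDerivAt (fun v : ℂ => -(r * v)) (-r : ℂ) v := by
      simpa using! ((hasDerivAt_id v).const_mul (r : ℂ)).neg
    exact (h1.cexp.const_mul (f r)).congr_deriv (by ring)

theorem laplaceConvergent_pow (k : ℕ) : LaplaceConvergent (fun r : ℝ => (r : ℂ) ^ k) 0 := by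
  induction k with
  | zero =>
    intro w hw
    simpa [neg_mul, mul_comm] using integrableOn_exp_mul_complex_Ioi (a := -w) (by simpa using hw) 0
  | succ k ih =>
    intro w hw
    refine (ih.neg_mul w hw).neg.congr_fun (fun r _ => ?_) measurableSet_Ioi
    simp only [Pi.neg_apply]; ring

theorem laplace_pow (k : ℕ) {w : ℂ} (hw : 0 < w.re) :
    laplace (fun r : ℝ => (r : ℂ) ^ k) w = k.factorial / w ^ (k + 1) := by
  induction k generalizing w with
  | zero =>
    have h := integral_exp_mul_complex_Ioi (a := -w) (by simpa using hw) 0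
    simpa [laplace, neg_mul, mul_comm] using h
  | succ k ih =>
    have hw0 : ∀ {v : ℂ}, 0 < v.re → v ≠ 0 := by rintro v hv rfl; simp at hv
    have h1 := (laplaceConvergent_pow k).hasDerivAt hw
    have h2 : HasDerivAt (fun v : ℂ => (k.factorial : ℂ) / v ^ (k + 1))
        (-(((k + 1).factorial : ℂ) / w ^ (k + 2))) w := by
      refine (((hasDerivAt_pow (k + 1) w).inv (pow_ne_zero _ (hw0 hw))).const_mul
        (k.factorial : ℂ)).congr_deriv ?_
      have := hw0 hw
      rw [Nat.factorial_succ]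
      push_cast
      field_simp
      ring
    have h3 : laplace (fun r : ℝ => (r : ℂ) ^ k) =ᶠ[nhds w]
        fun v : ℂ => (k.factorial : ℂ) / v ^ (k + 1) := by
      filter_upwards [(isOpen_lt continuous_const Complex.continuous_re).mem_nhds hw] with v hv
      exact ih hv
    have h4 := h1.unique (h2.congr_of_eventuallyEq h3)
    rw [← neg_inj, ← h4, laplace, laplace, ← integral_neg]
    refine integral_congr_ae (Filter.Eventually.of_forall fun r => ?_)
    ring

/-- Termwise Laplace transform of a power series `∑ c_k r^k / k!` with `|c_k| ≤ C R^k`. -/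
theorem hasSum_laplace {c : ℕ → ℂ} {C R : ℝ} (hR : 0 < R) (hc : ∀ k, ‖c k‖ ≤ C * R ^ k)
    {f : ℝ → ℂ} (hf : ∀ r : ℝ, HasSum (fun k => c k / k.factorial * (r : ℂ) ^ k) (f r))
    {w : ℂ} (hw : R < w.re) :
    HasSum (fun k => c k / w ^ (k + 1)) (laplace f w) := by
  have hw0 : 0 < w.re := hR.trans hw
  have hi : ∀ k : ℕ, IntegrableOn (fun r : ℝ => c k / k.factorial *
      ((r : ℂ) ^ k * Complex.exp (-(r * w)))) (Set.Ioi 0) :=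
    fun k => (laplaceConvergent_pow k w hw0).const_mul _
  have hnorm : ∀ k : ℕ, ∫ r in Set.Ioi (0 : ℝ), ‖c k / k.factorial *
      ((r : ℂ) ^ k * Complex.exp (-(r * w)))‖ = ‖c k‖ / w.re ^ (k + 1) := by
    intro k
    have h1 := laplace_pow k (w := (w.re : ℂ)) (by simpa using hw0)
    have h2 : laplace (fun r : ℝ => (r : ℂ) ^ k) (w.re : ℂ)
        = ((∫ r in Set.Ioi (0 : ℝ), r ^ k * Real.exp (-(r * w.re)) : ℝ) : ℂ) := by
      rw [laplace, ← integral_complex_ofReal]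
      push_cast
      rfl
    rw [h2] at h1
    have h3 : (∫ r in Set.Ioi (0 : ℝ), r ^ k * Real.exp (-(r * w.re)))
        = k.factorial / w.re ^ (k + 1) := by exact_mod_cast h1
    have h4 : ∀ r ∈ Set.Ioi (0 : ℝ), ‖c k / k.factorial * ((r : ℂ) ^ k * Complex.exp (-(r * w)))‖
        = ‖c k‖ / k.factorial * (r ^ k * Real.exp (-(r * w.re))) := by
      intro r hr
      have hr : 0 < r := hr
      simp [norm_exp_neg_ofReal_mul, abs_of_pos hr]
    rw [setIntegral_congr_fun measurableSet_Ioi h4, integral_const_mul, h3]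
    have := k.factorial_ne_zero
    field_simp
  have hs : Summable fun k : ℕ => ∫ r in Set.Ioi (0 : ℝ), ‖c k / k.factorial *
      ((r : ℂ) ^ k * Complex.exp (-(r * w)))‖ := by
    simp only [hnorm]
    have hg : Summable fun k : ℕ => C / w.re * (R / w.re) ^ k :=
      (summable_geometric_of_lt_one (by positivity) ((div_lt_one hw0).2 hw)).mul_left _
    refine Summable.of_nonneg_of_le (fun k => by positivity) (fun k => ?_) hg
    calc ‖c k‖ / w.re ^ (k + 1) ≤ C * R ^ k / w.re ^ (k + 1) := by
          gcongr; exact hc k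
      _ = _ := by rw [div_pow]; field_simp; ring
  have h := hasSum_integral_of_summable_integral_norm hi hs
  have e1 : ∀ k : ℕ, ∫ r in Set.Ioi (0 : ℝ), c k / k.factorial *
      ((r : ℂ) ^ k * Complex.exp (-(r * w))) = c k / w ^ (k + 1) := by
    intro k
    have h1 := laplace_pow k hw0
    rw [laplace] at h1
    rw [integral_const_mul, h1]
    have := k.factorial_ne_zero
    field_simp
  have e2 : ∀ r : ℝ, ∑' k : ℕ, c k / k.factorial * ((r : ℂ) ^ k * Complex.exp (-(r * w)))
      = f r * Complex.exp (-(r * w)) := by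
    intro r
    simp only [← mul_assoc]
    exact ((hf r).mul_right _).tsum_eq
  simpa only [e1, e2] using! h

namespace BoundedConvexDomain

variable (D : BoundedConvexDomain)

/-! ### The Borel transform as a Laplace transform along rays -/

theorem isOpen_halfPlane (φ : ℝ) : IsOpen {ζ : ℂ | D.support φ < height φ ζ} :=
  isOpen_lt continuous_const (continuous_height_right φ)

theorem halfPlane_subset (φ : ℝ) :
    {ζ : ℂ | D.support φ < height φ ζ} ⊆ (closure D.carrier)ᶜ :=
  fun _ hζ hc => (D.height_le_support hc φ).not_gt hζ

theorem convex_halfPlane (φ : ℝ) : Convex ℝ {ζ : ℂ | D.support φ < height φ ζ} := by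
  have h : IsLinearMap ℝ (height φ) := by
    constructor
    · intro x y; simp only [height_eq, Complex.add_re, Complex.add_im]; ring
    · intro c x
      simp only [height_eq, Complex.real_smul, Complex.re_ofReal_mul, Complex.im_ofReal_mul,
        smul_eq_mul]
      ring
  exact convex_halfSpace_gt h _

variable {D} {F γ : ℂ → ℂ}

/-- Termwise Laplace transform of the Taylor series gives the representation far out in the
half-plane; the identity theorem extends it as far as the Laplace integral converges. -/
theorem IsBorelPair.eqOn_laplace (hB : D.IsBorelPair F γ) {φ : ℝ}
    (hconv : LaplaceConvergent (fun r : ℝ => F (r * Complex.exp (φ * Complex.I)))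
      (D.support φ)) :
    Set.EqOn γ (fun ζ => Complex.exp (φ * Complex.I) *
        laplace (fun r : ℝ => F (r * Complex.exp (φ * Complex.I)))
          (ζ * Complex.exp (φ * Complex.I)))
      {ζ : ℂ | D.support φ < height φ ζ} := by
  set e := Complex.exp (φ * Complex.I) with he
  have he0 : e ≠ 0 := Complex.exp_ne_zero _
  have hen : ‖e‖ = 1 := Complex.norm_exp_ofReal_mul_I φ
  set f : ℝ → ℂ := fun r => F (r * e) with hf
  obtain ⟨R₀, hR₀⟩ : ∃ R₀ : ℝ, ∀ z : ℂ, R₀ ≤ ‖z‖ →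
      HasSum (fun k : ℕ => iteratedDeriv k F 0 / z ^ (k + 1)) (γ z) := by
    have h := hB.series
    rw [← comap_norm_atTop, Filter.eventually_comap, Filter.eventually_atTop] at h
    obtain ⟨R₀, h⟩ := h
    exact ⟨R₀, fun z hz => h _ hz z rfl⟩
  set R := max R₀ 1 with hRdef
  have hR : 0 < R := lt_of_lt_of_le one_pos (le_max_right _ _)
  obtain ⟨C, hC⟩ : ∃ C : ℝ, ∀ k, ‖iteratedDeriv k F 0‖ ≤ C * R ^ k := by
    have h := (hR₀ (R : ℂ) (by
      rw [Complex.norm_real, Real.norm_of_nonneg hR.le]; exact le_max_left _ _)).summable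
    obtain ⟨C, hC⟩ := h.tendsto_atTop_zero.norm.bddAbove_range
    refine ⟨C * R, fun k => ?_⟩
    have h1 := hC ⟨k, rfl⟩
    simp only [norm_div, norm_pow, Complex.norm_real, Real.norm_of_nonneg hR.le] at h1
    rw [div_le_iff₀ (by positivity)] at h1
    calc _ ≤ _ := h1
      _ = _ := by ring
  have hfs : ∀ r : ℝ,
      HasSum (fun k => (iteratedDeriv k F 0 * e ^ k) / k.factorial * (r : ℂ) ^ k) (f r) := by
    intro r
    convert! Complex.hasSum_taylorSeries_of_entire hB.entire 0 (r * e) using 1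
    funext k
    simp only [sub_zero, smul_eq_mul, mul_pow]
    ring
  have hbig : ∀ ζ : ℂ, R < height φ ζ → γ ζ = e * laplace f (ζ * e) := by
    intro ζ hζ
    have h1 := hasSum_laplace hR (c := fun k => iteratedDeriv k F 0 * e ^ k) (C := C)
      (by simpa [hen] using hC) hfs (w := ζ * e) hζ
    have hn : R₀ ≤ ‖ζ‖ := by
      have h2 : height φ ζ ≤ ‖ζ * e‖ := Complex.re_le_norm _
      rw [norm_mul, hen, mul_one] at h2
      exact (le_max_left R₀ 1).trans (hζ.le.trans h2)
    refine (hR₀ ζ hn).unique ?_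
    convert! h1.mul_left e using 1
    funext k
    have hζ0 : ζ ≠ 0 := by
      rintro rfl
      simp [height] at hζ
      linarith
    field_simp
    ring
  set U := {ζ : ℂ | D.support φ < height φ ζ} with hU
  have ha1 : AnalyticOnNhd ℂ γ U :=
    (hB.analytic.mono (D.halfPlane_subset φ)).analyticOnNhd (D.isOpen_halfPlane φ)
  have ha2 : AnalyticOnNhd ℂ (fun ζ => e * laplace f (ζ * e)) U := by
    refine DifferentiableOn.analyticOnNhd (fun ζ hζ => ?_) (D.isOpen_halfPlane φ)
    refine DifferentiableAt.differentiableWithinAt (DifferentiableAt.const_mul ?_ e)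
    exact DifferentiableAt.comp (g := laplace f) ζ
      (hconv.hasDerivAt (w := ζ * e) hζ).differentiableAt (differentiableAt_id.mul_const e)
  obtain ⟨z₀, hz₀⟩ : ∃ z₀, height φ z₀ = max R (D.support φ) + 1 := by
    refine ⟨0 + (max R (D.support φ) + 1 : ℝ) * Complex.exp (-(φ * Complex.I)), ?_⟩
    rw [height_add_mul_exp]; simp [height]
  refine ha1.eqOn_of_preconnected_of_eventuallyEq ha2 (D.convex_halfPlane φ).isPreconnected
    (z₀ := z₀) ?_ ?_
  · simp only [hU, Set.mem_ofPred_eq, hz₀]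
    linarith [le_max_right R (D.support φ)]
  · have hz : z₀ ∈ {ζ | R < height φ ζ} := by
      simp only [Set.mem_ofPred_eq, hz₀]
      linarith [le_max_left R (D.support φ)]
    filter_upwards [(isOpen_lt continuous_const (continuous_height_right φ)).mem_nhds hz] with ζ h
    exact hbig ζ h

theorem IsBorelPair.iteratedDeriv_two_eq (hB : D.IsBorelPair F γ) {φ : ℝ}
    (hconv : LaplaceConvergent (fun r : ℝ => F (r * Complex.exp (φ * Complex.I))) (D.support φ))
    {ζ : ℂ} (hζ : D.support φ < height φ ζ) :
    iteratedDeriv 2 γ ζ = Complex.exp (φ * Complex.I) ^ 3 *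
      laplace (fun r : ℝ => -r * (-r * F (r * Complex.exp (φ * Complex.I))))
        (ζ * Complex.exp (φ * Complex.I)) := by
  set e := Complex.exp (φ * Complex.I) with he
  have hd : ∀ {f : ℝ → ℂ}, LaplaceConvergent f (D.support φ) → ∀ (c z : ℂ),
      D.support φ < height φ z →
      HasDerivAt (fun z => c * laplace f (z * e))
        (c * e * laplace (fun r => -r * f r) (z * e)) z := by
    intro f hf c z hz
    have h1 : HasDerivAt (fun z : ℂ => z * e) e z := by simpa using (hasDerivAt_id z).mul_const e
    exact ((HasDerivAt.comp (h₂ := laplace f) z (hf.hasDerivAt (w := z * e) hz)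
      h1).const_mul c).congr_deriv (by ring)
  have hnh : ∀ {z : ℂ}, D.support φ < height φ z →
      {ζ : ℂ | D.support φ < height φ ζ} ∈ nhds z := fun hz => (D.isOpen_halfPlane φ).mem_nhds hz
  have h1 : ∀ z : ℂ, D.support φ < height φ z → deriv γ z = e * e *
      laplace (fun r : ℝ => -r * F (r * e)) (z * e) := by
    intro z hz
    refine ((hd hconv e z hz).congr_of_eventuallyEq ?_).deriv
    filter_upwards [hnh hz] with v hv
    exact hB.eqOn_laplace hconv hv
  rw [iteratedDeriv_succ, iteratedDeriv_one]
  refine (((hd hconv.neg_mul (e * e) ζ hζ).congr_of_eventuallyEq ?_).deriv).trans (by ring)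
  filter_upwards [hnh hζ] with v hv
  exact h1 v hv

/-! ### Consequences of the finiteness of the norm on a ray -/

variable (D)

theorem measurable_bergmanWeight : Measurable D.bergmanWeight := by
  have h : StronglyMeasurable (Function.uncurry fun l z : ℂ => ‖Complex.exp (l * z)‖ ^ 2) :=
    Continuous.stronglyMeasurable (by unfold Function.uncurry; fun_prop)
  exact (h.integral_prod_right (ν := volume.restrict D.carrier)).measurable

/-- The density of `‖F‖²` in polar coordinates. -/
noncomputable def radialDensity (β : ℝ) (F : ℂ → ℂ) (φ r : ℝ) : ℝ :=
  ‖F (r * Complex.exp (φ * Complex.I))‖ ^ 2 /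
    (D.bergmanWeight (r * Complex.exp (φ * Complex.I)) * r ^ (2 * β))

theorem measurable_radialDensity (β : ℝ) {F : ℂ → ℂ} (hF : Continuous F) :
    Measurable (Function.uncurry (D.radialDensity β F)) := by
  have hc : Continuous fun q : ℝ × ℝ => (q.2 : ℂ) * Complex.exp (q.1 * Complex.I) := by fun_prop
  exact ((hF.comp hc).norm.measurable.pow_const 2).div
    ((D.measurable_bergmanWeight.comp hc.measurable).mul (measurable_snd.pow_const (2 * β)))

theorem radialDensity_nonneg (β : ℝ) (F : ℂ → ℂ) (φ : ℝ) {r : ℝ} (hr : 0 < r) :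
    0 ≤ D.radialDensity β F φ r := by
  have := D.bergmanWeight_pos r φ hr
  unfold radialDensity
  positivity

theorem norm_sq_eq_radialDensity_mul (β : ℝ) (F : ℂ → ℂ) (φ : ℝ) {r : ℝ} (hr : 0 < r) :
    ‖F (r * Complex.exp (φ * Complex.I))‖ ^ 2 = D.radialDensity β F φ r *
      (D.bergmanWeight (r * Complex.exp (φ * Complex.I)) * r ^ (2 * β)) := by
  have h1 := D.bergmanWeight_pos r φ hr
  have h2 := Real.rpow_pos_of_pos hr (2 * β)
  rw [radialDensity, div_mul_cancel₀ _ (by positivity)]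

theorem integrableOn_radialDensity {β : ℝ} {F : ℂ → ℂ} (hF : Continuous F) {φ : ℝ}
    (hfin : ∫⁻ r in Set.Ioi (0 : ℝ), ENNReal.ofReal (D.radialDensity β F φ r) < ⊤) :
    IntegrableOn (D.radialDensity β F φ) (Set.Ioi 0) := by
  refine ⟨((D.measurable_radialDensity β hF).comp measurable_prodMk_left).aestronglyMeasurable, ?_⟩
  rw [hasFiniteIntegral_iff_ofReal]
  · exact hfin
  · filter_upwards [ae_restrict_mem measurableSet_Ioi] with r hr
    exact D.radialDensity_nonneg β F φ hr

/-- The Laplace integral of `F` along a ray of finite norm converges up to the support line. The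
condition `β > -1/2` makes the comparison function integrable at the origin. -/
theorem laplaceConvergent_of_lintegral_lt_top {β : ℝ} (hβ : -(1 / 2 : ℝ) < β) {F : ℂ → ℂ}
    (hF : Continuous F) {φ : ℝ}
    (hfin : ∫⁻ r in Set.Ioi (0 : ℝ), ENNReal.ofReal (D.radialDensity β F φ r) < ⊤) :
    LaplaceConvergent (fun r : ℝ => F (r * Complex.exp (φ * Complex.I))) (D.support φ) := by
  intro w hw
  have hc : Continuous fun r : ℝ => F (r * Complex.exp (φ * Complex.I)) *
      Complex.exp (-(r * w)) := by fun_prop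
  have h1 := D.integrableOn_radialDensity hF hfin
  have h2 : IntegrableOn (fun r : ℝ => volume.real D.carrier *
      (r ^ (2 * β) * Real.exp (-(2 * (w.re - D.support φ)) * r))) (Set.Ioi 0) := by
    have := integrableOn_rpow_mul_exp_neg_mul_rpow (p := 1) (s := 2 * β)
      (b := 2 * (w.re - D.support φ)) (by linarith) one_pos (by linarith)
    simp only [Real.rpow_one] at this
    exact this.const_mul _
  refine (h1.add h2).mono' hc.aestronglyMeasurable ?_
  filter_upwards [ae_restrict_mem measurableSet_Ioi] with r hr
  have hr : 0 < r := hr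
  have hK := D.bergmanWeight_pos r φ hr
  have hKle := D.bergmanWeight_le_area r φ hr
  have hE := D.radialDensity_nonneg β F φ hr
  have hN := D.norm_sq_eq_radialDensity_mul β F φ hr
  rw [norm_mul, norm_exp_neg_ofReal_mul, Pi.add_apply]
  set K := D.bergmanWeight (r * Complex.exp (φ * Complex.I))
  set E := D.radialDensity β F φ r
  set a := ‖F (r * Complex.exp (φ * Complex.I))‖
  have hp : 0 < r ^ (2 * β) := Real.rpow_pos_of_pos hr _
  set X := Real.exp (-(r * w.re)) with hX
  have hX0 : 0 < X := Real.exp_pos _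
  have hle : K * X ^ 2 ≤ volume.real D.carrier * Real.exp (-(2 * (w.re - D.support φ)) * r) := by
    calc _ ≤ _ := mul_le_mul_of_nonneg_right hKle (sq_nonneg X)
      _ = _ := by
        rw [hX, ← Real.exp_nat_mul, mul_assoc, ← Real.exp_add]
        congr 2
        push_cast
        ring
  have hm := mul_le_mul_of_nonneg_right hle hp.le
  -- `(aX)² = E c` with `c = K r^{2β} X²`, hence `aX ≤ E + c`
  have h3 : (a * X) ^ 2 = E * (K * r ^ (2 * β) * X ^ 2) := by rw [mul_pow, hN]; ring
  have hc0 : 0 ≤ K * r ^ (2 * β) * X ^ 2 := by positivity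
  have h4 : a * X ≤ E + K * r ^ (2 * β) * X ^ 2 := by
    refine abs_le_of_sq_le_sq' ?_ (by positivity) |>.2
    rw [h3]
    nlinarith [mul_nonneg hE hc0]
  refine h4.trans ?_
  nlinarith

theorem rpow_mul_exp_neg_le {s c r : ℝ} (hs : 0 < s) (hc : 0 < c) (hr : 0 < r) :
    r ^ s * Real.exp (-(c * r)) ≤ (s / c) ^ s := by
  have h1 : c * r / s ≤ Real.exp (c * r / s) := by linarith [Real.add_one_le_exp (c * r / s)]
  have h2 := Real.rpow_le_rpow (by positivity) h1 hs.le
  rw [← Real.exp_mul, div_mul_cancel₀ _ hs.ne'] at h2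
  have h3 : r = (s / c) * (c * r / s) := by field_simp
  rw [Real.exp_neg, ← div_eq_mul_inv, div_le_iff₀ (Real.exp_pos _)]
  calc r ^ s = (s / c) ^ s * (c * r / s) ^ s := by
        rw [← Real.mul_rpow (by positivity) (by positivity), ← h3]
    _ ≤ _ := mul_le_mul_of_nonneg_left h2 (by positivity)

/-- Square integrability of `r² F(re^{iφ}) e^{-rx}`, from the bound `K(re^{iφ}) ≤ |D| e^{2rh}`. -/
theorem integrableOn_sq_of_lintegral_lt_top {β : ℝ} (hβ : -(1 / 2 : ℝ) < β) {F : ℂ → ℂ}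
    (hF : Continuous F) {φ : ℝ}
    (hfin : ∫⁻ r in Set.Ioi (0 : ℝ), ENNReal.ofReal (D.radialDensity β F φ r) < ⊤)
    {x : ℝ} (hx : D.support φ < x) :
    IntegrableOn (fun r : ℝ => ‖F (r * Complex.exp (φ * Complex.I))‖ ^ 2 *
      (r ^ 4 * Real.exp (-(2 * r * x)))) (Set.Ioi 0) := by
  have hc : Continuous fun r : ℝ => ‖F (r * Complex.exp (φ * Complex.I))‖ ^ 2 *
      (r ^ 4 * Real.exp (-(2 * r * x))) := by fun_prop
  set B := ((2 * β + 4) / (2 * (x - D.support φ))) ^ (2 * β + 4) with hB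
  refine ((D.integrableOn_radialDensity hF hfin).mul_const (volume.real D.carrier * B)).mono'
    hc.aestronglyMeasurable ?_
  filter_upwards [ae_restrict_mem measurableSet_Ioi] with r hr
  have hr : 0 < r := hr
  have hE := D.radialDensity_nonneg β F φ hr
  rw [Real.norm_of_nonneg (by positivity), D.norm_sq_eq_radialDensity_mul β F φ hr, mul_assoc]
  refine mul_le_mul_of_nonneg_left ?_ hE
  have hKle := D.bergmanWeight_le_area r φ hr
  have hb := rpow_mul_exp_neg_le (s := 2 * β + 4) (c := 2 * (x - D.support φ)) (r := r)
    (by linarith) (by linarith) hr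
  have hp : r ^ (2 * β + 4) = r ^ (2 * β) * r ^ 4 := by
    rw [Real.rpow_add hr]; norm_cast
  have hpp : 0 < r ^ (2 * β) := Real.rpow_pos_of_pos hr _
  calc _ ≤ (volume.real D.carrier * Real.exp (2 * r * D.support φ)) * r ^ (2 * β) *
        (r ^ 4 * Real.exp (-(2 * r * x))) := by gcongr
    _ = volume.real D.carrier * (r ^ (2 * β + 4) *
        Real.exp (-(2 * (x - D.support φ) * r))) := by
      have e : Real.exp (-(2 * (x - D.support φ) * r))
          = Real.exp (2 * r * D.support φ) * Real.exp (-(2 * r * x)) := by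
        rw [← Real.exp_add]; ring_nf
      rw [hp, e]; ring
    _ ≤ _ := mul_le_mul_of_nonneg_left hb measureReal_nonneg

end BoundedConvexDomain

/-! ### Plancherel's theorem for Laplace transforms -/

/-- Plancherel's theorem on the vertical line `Re w = X` for a Laplace transform. -/
theorem lintegral_enorm_laplace_sq {f : ℝ → ℂ} {X : ℝ}
    (h1 : IntegrableOn (fun r : ℝ => f r * Complex.exp (-(r * X))) (Set.Ioi 0))
    (h2 : IntegrableOn (fun r : ℝ => ‖f r * Complex.exp (-(r * X))‖ ^ 2) (Set.Ioi 0)) :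
    ∫⁻ y : ℝ, ‖laplace f (X + y * Complex.I)‖ₑ ^ 2 = ENNReal.ofReal (2 * Real.pi) *
      ∫⁻ r in Set.Ioi (0 : ℝ), ‖f r * Complex.exp (-(r * X))‖ₑ ^ 2 := by
  set g : ℝ → ℂ := (Set.Ioi 0).indicator fun r : ℝ => f r * Complex.exp (-(r * X)) with hg
  have hg1 : Integrable g := (integrable_indicator_iff measurableSet_Ioi).2 h1
  have hg2 : MemLp g 2 := by
    rw [memLp_two_iff_integrable_sq_norm hg1.aestronglyMeasurable]
    have e : (fun r => ‖g r‖ ^ 2)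
        = (Set.Ioi 0).indicator fun r : ℝ => ‖f r * Complex.exp (-(r * X))‖ ^ 2 := by
      funext r
      by_cases hr : r ∈ Set.Ioi (0 : ℝ) <;> simp [hg, hr]
    rw [e]
    exact (integrable_indicator_iff measurableSet_Ioi).2 h2
  have hF : ∀ ξ : ℝ, FourierTransform.fourier g ξ
      = laplace f (X + ((2 * Real.pi * ξ : ℝ) : ℂ) * Complex.I) := by
    intro ξ
    rw [Real.fourier_real_eq_integral_exp_smul, laplace, ← integral_indicator measurableSet_Ioi]
    refine integral_congr_ae (Filter.Eventually.of_forall fun r => ?_)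
    by_cases hr : r ∈ Set.Ioi (0 : ℝ)
    · simp only [hg, Set.indicator_of_mem hr, smul_eq_mul]
      rw [mul_left_comm, ← Complex.exp_add]
      congr 2
      push_cast
      ring
    · simp [hg, hr]
  have h2pi : (2 * Real.pi) ≠ 0 := by positivity
  have hscale : ∫⁻ y : ℝ, ‖laplace f (X + y * Complex.I)‖ₑ ^ 2 = ENNReal.ofReal (2 * Real.pi) *
      ∫⁻ ξ : ℝ, ‖laplace f (X + ((2 * Real.pi * ξ : ℝ) : ℂ) * Complex.I)‖ₑ ^ 2 := by
    conv_lhs => rw [← Real.smul_map_volume_mul_left h2pi]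
    rw [lintegral_smul_measure, abs_of_pos (by positivity), smul_eq_mul]
    congr 1
    exact (Homeomorph.mulLeft₀ (2 * Real.pi) h2pi).measurableEmbedding.lintegral_map _
  rw [hscale]
  simp only [← hF]
  rw [lintegral_enorm_fourier_sq hg1 hg2, ← lintegral_indicator measurableSet_Ioi]
  congr 1
  refine lintegral_congr fun r => ?_
  by_cases hr : r ∈ Set.Ioi (0 : ℝ) <;> simp [hg, hr]

namespace BoundedConvexDomain

variable (D : BoundedConvexDomain)

/-! ### The Laplace transform of the weight -/

/-- The density `x^{2β+3} / s(-x, φ)` of the weight `p` at distance `x` from the support line. -/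
noncomputable def capWeight (β φ x : ℝ) : ℝ := x ^ (2 * β + 3) / D.stripArea (-x) φ

theorem measurable_capWeight (β : ℝ) : Measurable (Function.uncurry (D.capWeight β)) := by
  have ho : IsOpen {q : (ℝ × ℝ) × ℂ | q.2 ∈ D.carrier ∧
      D.support q.1.1 - q.1.2 < height q.1.1 q.2} := by
    have hc1 : Continuous fun q : (ℝ × ℝ) × ℂ => D.support q.1.1 - q.1.2 :=
      (D.continuous_support.comp (by fun_prop)).sub (by fun_prop)
    have hc2 : Continuous fun q : (ℝ × ℝ) × ℂ => height q.1.1 q.2 :=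
      continuous_height.comp (by fun_prop : Continuous fun q : (ℝ × ℝ) × ℂ => (q.1.1, q.2))
    exact (D.isOpen.preimage continuous_snd).inter (isOpen_lt hc1 hc2)
  have hm : Measurable fun q : ℝ × ℝ => D.stripArea (-q.2) q.1 := by
    simp only [stripArea_neg]
    exact (measurable_measure_prodMk_left (ν := volume) ho.measurableSet).ennreal_toReal
  exact (measurable_snd.pow_const _).div hm

/-- The growth bound for the cap areas replaces `1/S(x)` by `(1 + ρ²/x²)/S(ρ)`, where `ρ = 1/(2r)`,
which leaves two Gamma integrals. -/
theorem lintegral_capWeight_le {β : ℝ} (hβ : -(1 / 2 : ℝ) < β) (φ : ℝ) {r : ℝ} (hr : 0 < r) :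
    ∫⁻ x in Set.Ioi (0 : ℝ), ENNReal.ofReal (D.capWeight β φ x) *
        ENNReal.ofReal (Real.exp (-(2 * r * x)))
      ≤ ENNReal.ofReal ((Real.Gamma (2 * β + 4) + Real.Gamma (2 * β + 2)) *
        ((1 / (2 * r)) ^ (2 * β + 4) / D.stripArea (-(1 / (2 * r))) φ)) := by
  set ρ := 1 / (2 * r) with hρ
  have hρ0 : 0 < ρ := by positivity
  set S := D.stripArea (-ρ) φ with hS
  have hS0 : 0 < S := D.stripArea_neg_pos φ hρ0
  set G : ℝ → ℝ := fun x => S⁻¹ * (x ^ (2 * β + 4 - 1) * Real.exp (-(2 * r * x)) +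
    ρ ^ 2 * (x ^ (2 * β + 2 - 1) * Real.exp (-(2 * r * x)))) with hG
  have hint : ∀ a : ℝ, 0 < a →
      IntegrableOn (fun x : ℝ => x ^ (a - 1) * Real.exp (-(2 * r * x))) (Set.Ioi 0) := by
    intro a ha
    have := integrableOn_rpow_mul_exp_neg_mul_rpow (p := 1) (s := a - 1) (b := 2 * r)
      (by linarith) one_pos (by linarith)
    simpa only [Real.rpow_one, neg_mul] using this
  have hGi : IntegrableOn G (Set.Ioi 0) :=
    ((hint _ (by linarith)).add ((hint _ (by linarith)).const_mul _)).const_mul _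
  have hpt : ∀ x ∈ Set.Ioi (0 : ℝ), ENNReal.ofReal (D.capWeight β φ x) *
      ENNReal.ofReal (Real.exp (-(2 * r * x))) ≤ ENNReal.ofReal (G x) := by
    intro x hx
    have hx : 0 < x := hx
    rw [← ENNReal.ofReal_mul' (Real.exp_pos _).le]
    refine ENNReal.ofReal_le_ofReal ?_
    have h := D.one_div_stripArea_le φ (div_pos hx hρ0) hρ0
    rw [div_mul_cancel₀ _ hρ0.ne'] at h
    have e : x ^ (2 * β + 4 - 1) = x ^ (2 * β + 2 - 1) * x ^ 2 := by
      rw [← Real.rpow_natCast, ← Real.rpow_add hx]; congr 1; push_cast; ring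
    have e' : (2 * β + 3) = 2 * β + 4 - 1 := by ring
    have hp : 0 < x ^ (2 * β + 2 - 1) := Real.rpow_pos_of_pos hx _
    calc D.capWeight β φ x * Real.exp (-(2 * r * x))
        = x ^ (2 * β + 4 - 1) * (1 / D.stripArea (-x) φ) * Real.exp (-(2 * r * x)) := by
          rw [capWeight, e']; ring
      _ ≤ x ^ (2 * β + 4 - 1) * ((1 + ((x / ρ) ^ 2)⁻¹) / S) * Real.exp (-(2 * r * x)) := by
          gcongr
      _ = G x := by
          simp only [hG, e]
          generalize x ^ (2 * β + 2 - 1) = P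
          field_simp
  refine (setLIntegral_mono' measurableSet_Ioi hpt).trans (le_of_eq ?_)
  rw [← ofReal_integral_eq_lintegral_ofReal hGi]
  · congr 1
    rw [hG, integral_const_mul, integral_add (hint _ (by linarith))
      ((hint _ (by linarith)).const_mul _), integral_const_mul,
      Real.integral_rpow_mul_exp_neg_mul_Ioi (by linarith) (by positivity),
      Real.integral_rpow_mul_exp_neg_mul_Ioi (by linarith) (by positivity), ← hρ]
    have e : ρ ^ (2 * β + 4) = ρ ^ (2 * β + 2) * ρ ^ 2 := by
      rw [← Real.rpow_natCast, ← Real.rpow_add hρ0]; congr 1; push_cast; ring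
    rw [e]
    ring
  · filter_upwards [ae_restrict_mem measurableSet_Ioi] with x hx
    have hx : 0 < x := hx
    simp only [hG, Pi.zero_apply]
    positivity

/-- On `0 < x ≤ 1/(2r)` the cap area and the exponential are controlled by their values at the
right end. -/
theorem le_lintegral_capWeight {β : ℝ} (hβ : -(1 / 2 : ℝ) < β) (φ : ℝ) {r : ℝ} (hr : 0 < r) :
    ENNReal.ofReal (Real.exp (-1) / (2 * β + 4) *
        ((1 / (2 * r)) ^ (2 * β + 4) / D.stripArea (-(1 / (2 * r))) φ))
      ≤ ∫⁻ x in Set.Ioi (0 : ℝ), ENNReal.ofReal (D.capWeight β φ x) *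
        ENNReal.ofReal (Real.exp (-(2 * r * x))) := by
  set ρ := 1 / (2 * r) with hρ
  have hρ0 : 0 < ρ := by positivity
  set S := D.stripArea (-ρ) φ with hS
  have hS0 : 0 < S := D.stripArea_neg_pos φ hρ0
  have hi : IntervalIntegrable (fun x : ℝ => Real.exp (-1) / S * x ^ (2 * β + 3)) volume 0 ρ :=
    (intervalIntegral.intervalIntegrable_rpow' (by linarith)).const_mul _
  calc _ = ∫⁻ x in Set.Ioc 0 ρ, ENNReal.ofReal (Real.exp (-1) / S * x ^ (2 * β + 3)) := by
        rw [← ofReal_integral_eq_lintegral_ofReal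
          ((intervalIntegrable_iff_integrableOn_Ioc_of_le hρ0.le).1 hi)]
        · rw [← intervalIntegral.integral_of_le hρ0.le, intervalIntegral.integral_const_mul,
            integral_rpow (Or.inl (by linarith)),
            Real.zero_rpow (by linarith : 0 < 2 * β + 3 + 1).ne']
          congr 1
          have : 2 * β + 3 + 1 = 2 * β + 4 := by ring
          rw [this]
          ring
        · filter_upwards [ae_restrict_mem measurableSet_Ioc] with x hx
          have hx : 0 < x := hx.1
          simp only [Pi.zero_apply]
          positivity
    _ ≤ ∫⁻ x in Set.Ioc 0 ρ, ENNReal.ofReal (D.capWeight β φ x) *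
        ENNReal.ofReal (Real.exp (-(2 * r * x))) := by
        refine setLIntegral_mono' measurableSet_Ioc fun x hx => ?_
        have hx0 : 0 < x := hx.1
        rw [← ENNReal.ofReal_mul' (Real.exp_pos _).le]
        refine ENNReal.ofReal_le_ofReal ?_
        have h1 : D.stripArea (-x) φ ≤ S := D.stripArea_neg_mono φ hx.2
        have h2 := D.stripArea_neg_pos φ hx0
        have h3 : 2 * r * x ≤ 1 := by
          have := mul_le_mul_of_nonneg_left hx.2 (by positivity : 0 ≤ 2 * r)
          rwa [hρ, mul_one_div_cancel (by positivity)] at this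
        calc _ = x ^ (2 * β + 3) / S * Real.exp (-1) := by ring
          _ ≤ _ := by unfold capWeight; gcongr
    _ ≤ _ := lintegral_mono_set fun x hx => hx.1

/-- The constant of the upper estimate, up to the factor `2π` of Plancherel's theorem. -/
noncomputable def upperConst (β : ℝ) : ℝ :=
  (Real.Gamma (2 * β + 4) + Real.Gamma (2 * β + 2)) * layerConst * (1 / 2) ^ (2 * β + 4)

/-- The constant of the lower estimate, up to the factor `2π` of Plancherel's theorem. -/
noncomputable def lowerConst (β : ℝ) : ℝ :=
  Real.exp (-1) / (2 * β + 4) * Real.exp (-1) * (1 / 2) ^ (2 * β + 4)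

theorem upperConst_pos {β : ℝ} (hβ : -(1 / 2 : ℝ) < β) : 0 < upperConst β := by
  have h1 := Real.Gamma_pos_of_pos (by linarith : 0 < 2 * β + 4)
  have h2 := Real.Gamma_pos_of_pos (by linarith : 0 < 2 * β + 2)
  have h3 := layerConst_pos
  unfold upperConst
  positivity

theorem lowerConst_pos {β : ℝ} (hβ : -(1 / 2 : ℝ) < β) : 0 < lowerConst β := by
  have h1 : 0 < 2 * β + 4 := by linarith
  unfold lowerConst
  positivity

theorem one_div_two_mul_rpow {β r : ℝ} (hr : 0 < r) :
    r ^ 4 * (1 / (2 * r)) ^ (2 * β + 4) = (1 / 2) ^ (2 * β + 4) / r ^ (2 * β) := by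
  have e : (1 / (2 * r)) = (1 / 2) / r := by field_simp
  have e2 : r ^ (2 * β + 4) = r ^ (2 * β) * r ^ 4 := by
    rw [Real.rpow_add hr]; norm_cast
  have := Real.rpow_pos_of_pos hr (2 * β)
  rw [e, Real.div_rpow (by norm_num) hr.le, e2]
  field_simp

theorem mul_lintegral_capWeight_le {β : ℝ} (hβ : -(1 / 2 : ℝ) < β) (F : ℂ → ℂ) (φ : ℝ) {r : ℝ}
    (hr : 0 < r) :
    ENNReal.ofReal (‖F (r * Complex.exp (φ * Complex.I))‖ ^ 2 *
        (r ^ 4 * Real.exp (-(2 * r * D.support φ)))) *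
      ∫⁻ x in Set.Ioi (0 : ℝ), ENNReal.ofReal (D.capWeight β φ x) *
        ENNReal.ofReal (Real.exp (-(2 * r * x)))
      ≤ ENNReal.ofReal (upperConst β) * ENNReal.ofReal (D.radialDensity β F φ r) := by
  refine (mul_le_mul_right (D.lintegral_capWeight_le hβ φ hr) _).trans ?_
  rw [← ENNReal.ofReal_mul (by positivity), ← ENNReal.ofReal_mul (upperConst_pos hβ).le]
  refine ENNReal.ofReal_le_ofReal ?_
  have hK := D.bergmanWeight_pos r φ hr
  have hS := D.stripArea_neg_pos φ (by positivity : 0 < 1 / (2 * r))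
  have hKle := D.bergmanWeight_le r φ hr
  have hp := Real.rpow_pos_of_pos hr (2 * β)
  have h1 := Real.Gamma_pos_of_pos (by linarith : 0 < 2 * β + 4)
  have h2 := Real.Gamma_pos_of_pos (by linarith : 0 < 2 * β + 2)
  have h3 := layerConst_pos
  rw [Real.exp_neg]
  have hX := Real.exp_pos (2 * r * D.support φ)
  unfold upperConst radialDensity
  set a := ‖F (r * Complex.exp (φ * Complex.I))‖ ^ 2 with ha
  have ha0 : 0 ≤ a := sq_nonneg _
  set K := D.bergmanWeight (r * Complex.exp (φ * Complex.I))
  set S := D.stripArea (-(1 / (2 * r))) φ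
  set X := Real.exp (2 * r * D.support φ)
  set Γ := Real.Gamma (2 * β + 4) + Real.Gamma (2 * β + 2) with hΓ
  have hΓ0 : 0 < Γ := by positivity
  have hinv : 1 / (X * S) ≤ layerConst / K := by
    rw [div_le_div_iff₀ (by positivity) hK]; linarith
  calc _ = a * Γ * (r ^ 4 * (1 / (2 * r)) ^ (2 * β + 4)) * (1 / (X * S)) := by
        field_simp
    _ = a * Γ * ((1 / 2) ^ (2 * β + 4) / r ^ (2 * β)) * (1 / (X * S)) := by
        rw [one_div_two_mul_rpow hr]
    _ ≤ a * Γ * ((1 / 2) ^ (2 * β + 4) / r ^ (2 * β)) * (layerConst / K) :=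
        mul_le_mul_of_nonneg_left hinv (by positivity)
    _ = _ := by field_simp

theorem le_mul_lintegral_capWeight {β : ℝ} (hβ : -(1 / 2 : ℝ) < β) (F : ℂ → ℂ) (φ : ℝ) {r : ℝ}
    (hr : 0 < r) :
    ENNReal.ofReal (lowerConst β) * ENNReal.ofReal (D.radialDensity β F φ r) ≤
      ENNReal.ofReal (‖F (r * Complex.exp (φ * Complex.I))‖ ^ 2 *
        (r ^ 4 * Real.exp (-(2 * r * D.support φ)))) *
      ∫⁻ x in Set.Ioi (0 : ℝ), ENNReal.ofReal (D.capWeight β φ x) *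
        ENNReal.ofReal (Real.exp (-(2 * r * x))) := by
  refine le_trans ?_ (mul_le_mul_right (D.le_lintegral_capWeight hβ φ hr) _)
  rw [← ENNReal.ofReal_mul (lowerConst_pos hβ).le, ← ENNReal.ofReal_mul (by positivity)]
  refine ENNReal.ofReal_le_ofReal ?_
  have hK := D.bergmanWeight_pos r φ hr
  have hS := D.stripArea_neg_pos φ (by positivity : 0 < 1 / (2 * r))
  have hKle := D.le_bergmanWeight r φ hr
  have hp := Real.rpow_pos_of_pos hr (2 * β)
  have hb : 0 < 2 * β + 4 := by linarith
  rw [Real.exp_neg (2 * r * D.support φ)]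
  have hX := Real.exp_pos (2 * r * D.support φ)
  unfold lowerConst radialDensity
  set a := ‖F (r * Complex.exp (φ * Complex.I))‖ ^ 2 with ha
  have ha0 : 0 ≤ a := sq_nonneg _
  set K := D.bergmanWeight (r * Complex.exp (φ * Complex.I))
  set S := D.stripArea (-(1 / (2 * r))) φ
  set X := Real.exp (2 * r * D.support φ)
  set c := Real.exp (-1) with hc
  have hc0 : 0 < c := Real.exp_pos _
  have hinv : c / K ≤ 1 / (X * S) := by
    rw [div_le_div_iff₀ hK (by positivity)]; linarith
  calc _ = a * (c / (2 * β + 4)) * ((1 / 2) ^ (2 * β + 4) / r ^ (2 * β)) * (c / K) := by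
        field_simp
    _ ≤ a * (c / (2 * β + 4)) * ((1 / 2) ^ (2 * β + 4) / r ^ (2 * β)) * (1 / (X * S)) :=
        mul_le_mul_of_nonneg_left hinv (by positivity)
    _ = a * (c / (2 * β + 4)) * (r ^ 4 * (1 / (2 * r)) ^ (2 * β + 4)) * (1 / (X * S)) := by
        rw [one_div_two_mul_rpow hr]
    _ = _ := by field_simp

/-! ### Comparison of the two norms -/

/-- Plancherel's theorem on the line at distance `x` from the support line in direction `φ`. -/
theorem lintegral_iteratedDeriv_line {β : ℝ} (hβ : -(1 / 2 : ℝ) < β) {F γ : ℂ → ℂ}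
    (hB : D.IsBorelPair F γ) {φ : ℝ}
    (hfin : ∫⁻ r in Set.Ioi (0 : ℝ), ENNReal.ofReal (D.radialDensity β F φ r) < ⊤)
    {x : ℝ} (hx : 0 < x) :
    ∫⁻ y : ℝ, ENNReal.ofReal (‖iteratedDeriv 2 γ (D.frame φ (x, y))‖ ^ 2) =
      ENNReal.ofReal (2 * Real.pi) * ∫⁻ r in Set.Ioi (0 : ℝ),
        ENNReal.ofReal (‖F (r * Complex.exp (φ * Complex.I))‖ ^ 2 *
          (r ^ 4 * Real.exp (-(2 * r * D.support φ)))) *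
        ENNReal.ofReal (Real.exp (-(2 * r * x))) := by
  have hF := hB.entire.continuous
  have hconv := D.laplaceConvergent_of_lintegral_lt_top hβ hF hfin
  have hconv2 := hconv.neg_mul.neg_mul
  set f : ℝ → ℂ := fun r : ℝ => -r * (-r * F (r * Complex.exp (φ * Complex.I))) with hf
  have hsq : ∀ r : ℝ, ‖f r * Complex.exp (-(r * ((D.support φ + x : ℝ) : ℂ)))‖ ^ 2 =
      ‖F (r * Complex.exp (φ * Complex.I))‖ ^ 2 *
        (r ^ 4 * Real.exp (-(2 * r * (D.support φ + x)))) := by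
    intro r
    rw [norm_mul, norm_exp_neg_ofReal_mul, Complex.ofReal_re, mul_pow, ← Real.exp_nat_mul]
    simp only [hf, norm_mul, norm_neg, Complex.norm_real, Real.norm_eq_abs, ← mul_assoc,
      abs_mul_abs_self]
    rw [mul_pow, mul_comm ((r * r) ^ 2)]
    have e : ((2 : ℕ) : ℝ) * -(r * (D.support φ + x)) = -(2 * r * (D.support φ + x)) := by
      push_cast; ring
    rw [e]
    ring
  have h1 := hconv2 ((D.support φ + x : ℝ) : ℂ) (by rw [Complex.ofReal_re]; linarith)
  have h2 := D.integrableOn_sq_of_lintegral_lt_top hβ hF hfin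
    (by linarith : D.support φ < D.support φ + x)
  have h := lintegral_enorm_laplace_sq h1 (by simpa only [hsq] using h2)
  have hl : ∀ y : ℝ, ENNReal.ofReal (‖iteratedDeriv 2 γ (D.frame φ (x, y))‖ ^ 2) =
      ‖laplace f (((D.support φ + x : ℝ) : ℂ) + y * Complex.I)‖ₑ ^ 2 := by
    intro y
    rw [hB.iteratedDeriv_two_eq hconv (by rw [height_frame]; simpa using hx), norm_mul, norm_pow,
      Complex.norm_exp_ofReal_mul_I, one_pow, one_mul, frame_mul_exp,
      ENNReal.ofReal_pow (norm_nonneg _), ofReal_norm]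
    push_cast
    rw [← add_assoc]
  simp only [hl]
  rw [h]
  congr 1
  refine lintegral_congr fun r => ?_
  rw [← ofReal_norm, ← ENNReal.ofReal_pow (norm_nonneg _), hsq,
    ← ENNReal.ofReal_mul' (Real.exp_pos _).le]
  have e : Real.exp (-(2 * r * (D.support φ + x)))
      = Real.exp (-(2 * r * D.support φ)) * Real.exp (-(2 * r * x)) := by
    rw [← Real.exp_add]; ring_nf
  rw [e]
  ring_nf

/-- The part of the weighted integral of `|γ''|²` that comes from the direction `φ`. -/
noncomputable def directionEnergy (β : ℝ) (γ : ℂ → ℂ) (φ : ℝ) : ENNReal :=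
  ∫⁻ x in Set.Ioi (0 : ℝ), ENNReal.ofReal (D.capWeight β φ x) *
    ∫⁻ y : ℝ, ENNReal.ofReal (‖iteratedDeriv 2 γ (D.frame φ (x, y))‖ ^ 2)

/-- The contribution of a direction in terms of `F`, by Plancherel's theorem on each line parallel
to the support line and an exchange of the integrations in `x` and `r`. -/
theorem directionEnergy_eq {β : ℝ} (hβ : -(1 / 2 : ℝ) < β) {F γ : ℂ → ℂ}
    (hB : D.IsBorelPair F γ) {φ : ℝ}
    (hfin : ∫⁻ r in Set.Ioi (0 : ℝ), ENNReal.ofReal (D.radialDensity β F φ r) < ⊤) :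
    D.directionEnergy β γ φ = ENNReal.ofReal (2 * Real.pi) * ∫⁻ r in Set.Ioi (0 : ℝ),
      ENNReal.ofReal (‖F (r * Complex.exp (φ * Complex.I))‖ ^ 2 *
        (r ^ 4 * Real.exp (-(2 * r * D.support φ)))) *
      ∫⁻ x in Set.Ioi (0 : ℝ), ENNReal.ofReal (D.capWeight β φ x) *
        ENNReal.ofReal (Real.exp (-(2 * r * x))) := by
  have hF := hB.entire.continuous
  have hw : Measurable fun x => ENNReal.ofReal (D.capWeight β φ x) :=
    ((D.measurable_capWeight β).comp measurable_prodMk_left).ennreal_ofReal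
  have ha : Measurable fun r : ℝ => ENNReal.ofReal (‖F (r * Complex.exp (φ * Complex.I))‖ ^ 2 *
        (r ^ 4 * Real.exp (-(2 * r * D.support φ)))) :=
    (by fun_prop : Continuous fun r : ℝ => ‖F (r * Complex.exp (φ * Complex.I))‖ ^ 2 *
        (r ^ 4 * Real.exp (-(2 * r * D.support φ)))).measurable.ennreal_ofReal
  have he : Measurable fun q : ℝ × ℝ => ENNReal.ofReal (Real.exp (-(2 * q.2 * q.1))) :=
    (by fun_prop : Continuous fun q : ℝ × ℝ =>
      Real.exp (-(2 * q.2 * q.1))).measurable.ennreal_ofReal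
  have h1 : D.directionEnergy β γ φ = ∫⁻ x in Set.Ioi (0 : ℝ), ENNReal.ofReal (2 * Real.pi) *
      ∫⁻ r in Set.Ioi (0 : ℝ), ENNReal.ofReal (D.capWeight β φ x) *
        (ENNReal.ofReal (‖F (r * Complex.exp (φ * Complex.I))‖ ^ 2 *
          (r ^ 4 * Real.exp (-(2 * r * D.support φ)))) *
        ENNReal.ofReal (Real.exp (-(2 * r * x)))) := by
    refine setLIntegral_congr_fun measurableSet_Ioi fun x hx => ?_
    rw [D.lintegral_iteratedDeriv_line hβ hB hfin hx, mul_left_comm,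
      lintegral_const_mul' _ _ ENNReal.ofReal_ne_top]
  have hm : Measurable (Function.uncurry fun x r : ℝ => ENNReal.ofReal (D.capWeight β φ x) *
        (ENNReal.ofReal (‖F (r * Complex.exp (φ * Complex.I))‖ ^ 2 *
          (r ^ 4 * Real.exp (-(2 * r * D.support φ)))) *
        ENNReal.ofReal (Real.exp (-(2 * r * x))))) :=
    (hw.comp measurable_fst).mul ((ha.comp measurable_snd).mul he)
  rw [h1, lintegral_const_mul' _ _ ENNReal.ofReal_ne_top, lintegral_lintegral_swap hm.aemeasurable]
  congr 1
  refine lintegral_congr fun r => ?_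
  rw [← lintegral_const_mul' _ _ ENNReal.ofReal_ne_top]
  exact lintegral_congr fun x => mul_left_comm _ _ _

theorem directionEnergy_le {β : ℝ} (hβ : -(1 / 2 : ℝ) < β) {F γ : ℂ → ℂ}
    (hB : D.IsBorelPair F γ) {φ : ℝ}
    (hfin : ∫⁻ r in Set.Ioi (0 : ℝ), ENNReal.ofReal (D.radialDensity β F φ r) < ⊤) :
    D.directionEnergy β γ φ ≤ ENNReal.ofReal (2 * Real.pi * upperConst β) *
      ∫⁻ r in Set.Ioi (0 : ℝ), ENNReal.ofReal (D.radialDensity β F φ r) := by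
  rw [D.directionEnergy_eq hβ hB hfin, ENNReal.ofReal_mul (p := 2 * Real.pi) (by positivity),
    mul_assoc, ← lintegral_const_mul' (ENNReal.ofReal (upperConst β)) _ ENNReal.ofReal_ne_top]
  exact mul_le_mul_right (setLIntegral_mono' measurableSet_Ioi
    fun r (hr : 0 < r) => D.mul_lintegral_capWeight_le hβ F φ hr) _

theorem le_directionEnergy {β : ℝ} (hβ : -(1 / 2 : ℝ) < β) {F γ : ℂ → ℂ}
    (hB : D.IsBorelPair F γ) {φ : ℝ}
    (hfin : ∫⁻ r in Set.Ioi (0 : ℝ), ENNReal.ofReal (D.radialDensity β F φ r) < ⊤) :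
    ENNReal.ofReal (2 * Real.pi * lowerConst β) *
      ∫⁻ r in Set.Ioi (0 : ℝ), ENNReal.ofReal (D.radialDensity β F φ r)
        ≤ D.directionEnergy β γ φ := by
  rw [D.directionEnergy_eq hβ hB hfin, ENNReal.ofReal_mul (p := 2 * Real.pi) (by positivity),
    mul_assoc, ← lintegral_const_mul' (ENNReal.ofReal (lowerConst β)) _ ENNReal.ofReal_ne_top]
  exact mul_le_mul_right (setLIntegral_mono' measurableSet_Ioi
    fun r (hr : 0 < r) => D.le_mul_lintegral_capWeight hβ F φ hr) _

/-- Tonelli's theorem: the points `ζ` off the closure of `D` together with their separating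
directions are the directions together with the points of the half-planes they cut off. -/
theorem lintegral_weight_eq (β : ℝ) {γ : ℂ → ℂ} (hγ : DifferentiableOn ℂ γ (closure D.carrier)ᶜ) :
    ∫⁻ ζ in (closure D.carrier)ᶜ, ENNReal.ofReal (‖iteratedDeriv 2 γ ζ‖ ^ 2) * D.weight β ζ
      = ∫⁻ φ, D.directionEnergy β γ φ ∂D.circleArcMeasure := by
  have : SFinite D.circleArcMeasure := by unfold circleArcMeasure arcMeasure; infer_instance
  set C := (closure D.carrier)ᶜ with hC
  have hCo : IsOpen C := isClosed_closure.isOpen_compl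
  set G : ℂ → ENNReal := C.indicator fun ζ => ENNReal.ofReal (‖iteratedDeriv 2 γ ζ‖ ^ 2) with hG
  have hGm : Measurable G := by
    have hc : ContinuousOn (iteratedDeriv 2 γ) C := by
      rw [iteratedDeriv_succ, iteratedDeriv_one]
      exact ((hγ.deriv hCo).deriv hCo).continuousOn
    have hc2 : ContinuousOn (fun ζ => ENNReal.ofReal (‖iteratedDeriv 2 γ ζ‖ ^ 2)) C :=
      ENNReal.continuous_ofReal.comp_continuousOn (hc.norm.pow 2)
    classical
    rw [hG, ← Set.piecewise_eq_indicator]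
    exact hc2.measurable_piecewise continuousOn_const hCo.measurableSet
  -- `V (ζ, θ)` is the density of the weight at `ζ`, extended by zero to the pairs for which the
  -- support line in direction `θ` does not separate `ζ` from `D`
  set P : Set (ℂ × ℝ) := {q | D.support q.2 < height q.2 q.1} with hP
  have hdist : Continuous fun q : ℂ × ℝ => height q.2 q.1 - D.support q.2 :=
    (continuous_height.comp (continuous_snd.prodMk continuous_fst)).sub
      (D.continuous_support.comp continuous_snd)
  have hPo : IsOpen P := by
    have := isOpen_lt continuous_const hdist (f := fun _ => (0 : ℝ))
    simpa only [sub_pos] using this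
  set V : ℂ × ℝ → ENNReal := P.indicator fun q =>
    ENNReal.ofReal (D.capWeight β q.2 (height q.2 q.1 - D.support q.2)) with hV
  have hVm : Measurable V :=
    (((D.measurable_capWeight β).comp
      (measurable_snd.prodMk hdist.measurable)).ennreal_ofReal).indicator hPo.measurableSet
  have hw : ∀ ζ, D.weight β ζ = ∫⁻ θ, V (ζ, θ) ∂D.circleArcMeasure := by
    intro ζ
    have hs : MeasurableSet (D.separatingDirections ζ) :=
      (isOpen_lt D.continuous_support
        (continuous_height.comp (Continuous.prodMk_left ζ))).measurableSet
    rw [weight, ← lintegral_indicator hs]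
    refine lintegral_congr fun θ => ?_
    by_cases h : D.support θ < height θ ζ
    · have h1 : θ ∈ D.separatingDirections ζ := h
      have h2 : (ζ, θ) ∈ P := h
      rw [Set.indicator_of_mem h1, hV, Set.indicator_of_mem h2, capWeight, neg_sub]
    · have h1 : θ ∉ D.separatingDirections ζ := h
      have h2 : (ζ, θ) ∉ P := h
      rw [Set.indicator_of_notMem h1, hV, Set.indicator_of_notMem h2]
  have hVζ : ∀ ζ, Measurable fun θ => V (ζ, θ) := fun ζ => hVm.comp measurable_prodMk_left
  have h1 : ∫⁻ ζ in C, ENNReal.ofReal (‖iteratedDeriv 2 γ ζ‖ ^ 2) * D.weight β ζ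
      = ∫⁻ ζ, ∫⁻ θ, G ζ * V (ζ, θ) ∂D.circleArcMeasure := by
    rw [← lintegral_indicator hCo.measurableSet]
    refine lintegral_congr fun ζ => ?_
    rw [lintegral_const_mul _ (hVζ ζ), ← hw, hG]
    by_cases h : ζ ∈ C <;> simp [h]
  have hm : Measurable (Function.uncurry fun ζ θ => G ζ * V (ζ, θ)) :=
    (hGm.comp measurable_fst).mul hVm
  rw [h1, lintegral_lintegral_swap hm.aemeasurable]
  refine lintegral_congr fun φ => ?_
  have hmφ : Measurable fun ζ => G ζ * V (ζ, φ) := hm.comp measurable_prodMk_right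
  rw [← (D.measurePreserving_frame φ).lintegral_comp hmφ, Measure.volume_eq_prod,
    lintegral_prod (fun q => G (D.frame φ q) * V (D.frame φ q, φ))
      (hmφ.comp (D.frame φ).measurable).aemeasurable, directionEnergy,
    ← lintegral_indicator measurableSet_Ioi]
  refine lintegral_congr fun x => ?_
  by_cases hx : x ∈ Set.Ioi (0 : ℝ)
  · rw [Set.indicator_of_mem hx, ← lintegral_const_mul' _ _ ENNReal.ofReal_ne_top]
    refine lintegral_congr fun y => ?_
    have hh : D.support φ < height φ (D.frame φ (x, y)) := by
      rw [height_frame]; simpa using hx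
    have h2 : (D.frame φ (x, y), φ) ∈ P := hh
    rw [hG, Set.indicator_of_mem (D.halfPlane_subset φ hh), hV, Set.indicator_of_mem h2, mul_comm,
      height_frame, add_sub_cancel_left]
  · rw [Set.indicator_of_notMem hx]
    have h2 : ∀ y, (D.frame φ (x, y), φ) ∉ P := by
      intro y
      simp only [hP, Set.mem_ofPred_eq, height_frame]
      have : x ≤ 0 := not_lt.1 hx
      linarith
    simp [hV, h2]

theorem normSq_eq (β : ℝ) (F : ℂ → ℂ) : D.normSq β F =
    ∫⁻ φ, ∫⁻ r in Set.Ioi (0 : ℝ), ENNReal.ofReal (D.radialDensity β F φ r) ∂volume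
      ∂D.circleArcMeasure := rfl

theorem ae_lintegral_radialDensity_lt_top {β : ℝ} {F : ℂ → ℂ} (hF : Continuous F)
    (hfin : D.normSq β F < ⊤) : ∀ᵐ φ ∂D.circleArcMeasure,
      ∫⁻ r in Set.Ioi (0 : ℝ), ENNReal.ofReal (D.radialDensity β F φ r) < ⊤ :=
  ae_lt_top (D.measurable_radialDensity β hF).ennreal_ofReal.lintegral_prod_right' hfin.ne

end BoundedConvexDomain

theorem mainTheorem3 (β : ℝ) (hβ : -(1 / 2 : ℝ) < β) :
    ∃ a A : ℝ, 0 < a ∧ 0 < A ∧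
      ∀ (D : BoundedConvexDomain) (F γ : ℂ → ℂ), D.IsBorelPair F γ → D.normSq β F < ⊤ →
        ENNReal.ofReal a * D.normSq β F ≤
            ∫⁻ ζ in (closure D.carrier)ᶜ,
              ENNReal.ofReal (‖iteratedDeriv 2 γ ζ‖ ^ 2) * D.weight β ζ ∧
          ∫⁻ ζ in (closure D.carrier)ᶜ,
              ENNReal.ofReal (‖iteratedDeriv 2 γ ζ‖ ^ 2) * D.weight β ζ ≤
            ENNReal.ofReal A * D.normSq β F := by
  have hl := BoundedConvexDomain.lowerConst_pos hβ
  have hu := BoundedConvexDomain.upperConst_pos hβ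
  refine ⟨2 * Real.pi * BoundedConvexDomain.lowerConst β,
    2 * Real.pi * BoundedConvexDomain.upperConst β, by positivity, by positivity, ?_⟩
  intro D F γ hB hfin
  have hae := D.ae_lintegral_radialDensity_lt_top hB.entire.continuous hfin
  rw [D.lintegral_weight_eq β hB.analytic, D.normSq_eq,
    ← lintegral_const_mul' _ _ ENNReal.ofReal_ne_top,
    ← lintegral_const_mul' _ _ ENNReal.ofReal_ne_top]
  constructor
  · exact lintegral_mono_ae (hae.mono fun φ h => D.le_directionEnergy hβ hB h)
  · exact lintegral_mono_ae (hae.mono fun φ h => D.directionEnergy_le hβ hB h)
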